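/- Let $N\ge 2$. Consider two rings, left ($L$) and right ($R$), each of $N$ three-state spins with local basis $|0\rangle,|1\rangle,|x\rangle$ and sites numbered $1,\dots,N$ modulo $N$. For a ring, let $P_i=|x\rangle_i\langle x|$, let $S_i=\sum_{a,b}|ab\rangle_{i,i+1}\langle ba|$ be the swap of sites $i,i+1$, and $F_i=S_iP_i$; superscripts $L,R$ indicate the ring. Let $|\Psi^-\rangle=(|01\rangle-|10\rangle)/\sqrt2$ and define $$H_{L/R}=\sum_{i=1}^{N-1}\left(P_i^{L/R}+P_{i+1}^{L/R}-F_i^{L/R}-(F_i^{L/R})^\dagger\right),$$ $$H_B=P_N^LP_N^R+P_1^LP_1^R-F_N^LF_N^R-(F_N^L)^\dagger(F_N^R)^\dagger,$$ $$H_P=(I-P_1^L)(I-P_1^R)-|\Psi^-\rangle_1^{LR}\langle\Psi^-|,$$ $$H_V=\sum_{\rho\in\{L,R\}}\left(V_1-V_1\sum_{i=1}^{N}P_i^{\rho}+V_2\sum_{i=1}^{N}P_i^{\rho}P_{i+1}^{\rho}\right),$$ with $V_1=1/N^4$ and $V_2=1$. Let $H=H_L+H_R+H_B+H_P+H_V$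 on $(\mathbb C^3)^{\otimes 2N}$. There are constants $c,c'>0$ independent of $N$ such that for every $N\ge 2$ the operator $H$ is self-adjoint and: (a) $H$ has a nondegenerate ground state $|g\rangle$ (a unit vector, unique up to a phase); (b) the spectral gap $\Delta$ of $H$, i.e. the distance from the ground state energy to the next energy level, satisfies $\Delta\ge c/(N^4\log N)$; (c) the reduced density matrices $\rho_L=\mathrm{tr}_R|g\rangle\langle g|$ and $\rho_R=\mathrm{tr}_L|g\rangle\langle g|$ satisfy $S(\rho_L)=S(\rho_R)\ge N-1$, where $S(\rho)=-\mathrm{tr}\,\rho\log_2\rho$ is the von Neumann entropy in bits. Consequently $0<\Delta<1$ and the entropy of one ring satisfies $S(\rho_L)=S(\rho_R)\ge c'\,(-\Delta\log\Delta)^{-1/4}$, a lower bound that is polynomial in $1/\Delta$ up to a logarithmic factor. -/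

import Mathlib

open scoped Kronecker

noncomputable section

namespace TwoRing

/-- Computational basis of a ring of `N` three-state spins. Sites are labelled modulo `N`, so the
sites `1, …, N - 1, N` are `1, …, N - 1, 0 : ZMod N`. The local values `0`, `1` are the two
qubit states and `2` is the hole state `x`. -/
abbrev Conf (N : ℕ) : Type := ZMod N → Fin 3

/-- Operators on the Hilbert space of one ring, as matrices in the computational basis. -/
abbrev RingOp (N : ℕ) : Type := Matrix (Conf N) (Conf N) ℂ

/-- Operators on the Hilbert space of the two rings; the first factor is the left ring. -/
abbrev PairOp (N : ℕ) : Type := Matrix (Conf N × Conf N) (Conf N × Conf N) ℂ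

section OneRing

variable (N : ℕ) [NeZero N]

/-- The projector `|x⟩⟨x|` at site `i`. -/
def holeAt (i : ZMod N) : RingOp N :=
  Matrix.diagonal fun c => if c i = 2 then 1 else 0

/-- `S_i`: exchange of the states of the sites `i` and `i + 1`. -/
def swapAt (i : ZMod N) : RingOp N :=
  Matrix.of fun c d => if c = d ∘ Equiv.swap i (i + 1) then 1 else 0

/-- `F_i = S_i |x⟩⟨x|_i`. -/
def hop (i : ZMod N) : RingOp N := swapAt N i * holeAt N i

/-- The hopping term of one ring. The sum runs over the bonds `(i, i + 1)` with
`i = 1, …, N - 1`, that is, over all bonds except the bond `(N, 1)`. -/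
def ringHopping : RingOp N :=
  ∑ i ∈ Finset.univ.erase (0 : ZMod N),
    (holeAt N i + holeAt N (i + 1) - hop N i - (hop N i).conjTranspose)

/-- The self-energy term of the holes of one ring (all `N` bonds in the last sum). -/
def ringPotential (V₁ V₂ : ℝ) : RingOp N :=
  (V₁ : ℂ) • (1 : RingOp N) - (V₁ : ℂ) • ∑ i : ZMod N, holeAt N i
    + (V₂ : ℂ) • ∑ i : ZMod N, holeAt N i * holeAt N (i + 1)

/-- `H_L`. -/
def HL : PairOp N := ringHopping N ⊗ₖ (1 : RingOp N)

/-- `H_R`. -/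
def HR : PairOp N := (1 : RingOp N) ⊗ₖ ringHopping N

/-- `H_B`: joint hopping of two holes between the sites `N` (that is, `0`) and `1`. -/
def HB : PairOp N :=
  holeAt N 0 ⊗ₖ holeAt N 0 + holeAt N 1 ⊗ₖ holeAt N 1
    - hop N 0 ⊗ₖ hop N 0 - (hop N 0).conjTranspose ⊗ₖ (hop N 0).conjTranspose

/-- Amplitudes `⟨ab|Ψ⁻⟩` of the singlet `(|01⟩ - |10⟩)/√2`. -/
def singlet (a b : Fin 3) : ℂ :=
  if a = 0 ∧ b = 1 then 1 / (Real.sqrt 2 : ℂ)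
  else if a = 1 ∧ b = 0 then -(1 / (Real.sqrt 2 : ℂ))
  else 0

/-- `|Ψ⁻⟩⟨Ψ⁻|` on the two sites numbered `1`, identity on all other sites. -/
def singletProj : PairOp N :=
  Matrix.of fun c d =>
    if ∀ j : ZMod N, j ≠ 1 → c.1 j = d.1 j ∧ c.2 j = d.2 j then
      singlet (c.1 1) (c.2 1) * star (singlet (d.1 1) (d.2 1))
    else 0

/-- `H_P`. -/
def HP : PairOp N := (1 - holeAt N 1) ⊗ₖ (1 - holeAt N 1) - singletProj N

/-- `H_V`. -/
def HV (V₁ V₂ : ℝ) : PairOp N :=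
  ringPotential N V₁ V₂ ⊗ₖ (1 : RingOp N) + (1 : RingOp N) ⊗ₖ ringPotential N V₁ V₂

/-- The two-ring Hamiltonian `H = H_L + H_R + H_B + H_P + H_V`. -/
def hamiltonian (V₁ V₂ : ℝ) : PairOp N := HL N + HR N + HB N + HP N + HV N V₁ V₂

end OneRing

section Spectrum

variable {ι : Type*} [Fintype ι] [DecidableEq ι]

/-- The eigenspace of `H` with energy `E`. -/
def energySpace (H : Matrix ι ι ℂ) (E : ℝ) : Submodule ℂ (ι → ℂ) :=
  Module.End.eigenspace (Matrix.toLin' H) (E : ℂ)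

/-- The set of energy levels (eigenvalues) of `H`. -/
def energies (H : Matrix ι ι ℂ) : Set ℝ :=
  {E | Module.End.HasEigenvalue (Matrix.toLin' H) (E : ℂ)}

/-- `E` is the ground state energy of `H`, and the ground state is nondegenerate. -/
def IsNondegenerateGroundEnergy (H : Matrix ι ι ℂ) (E : ℝ) : Prop :=
  IsLeast (energies H) E ∧ Module.finrank ℂ (energySpace H E) = 1

/-- `Δ` is the spectral gap above the ground state energy `E₀`: the distance from `E₀` to the
lowest energy level above it. -/
def IsGapAbove (H : Matrix ι ι ℂ) (E₀ Δ : ℝ) : Prop :=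
  IsLeast {E | E ∈ energies H ∧ E₀ < E} (E₀ + Δ)

/-- Von Neumann entropy, in bits, `-∑ λ log₂ λ` over the eigenvalues with multiplicity. -/
def entropy (ρ : Matrix ι ι ℂ) (hρ : ρ.IsHermitian) : ℝ :=
  -∑ i, hρ.eigenvalues i * Real.logb 2 (hρ.eigenvalues i)

end Spectrum

section Reduced

/-- Reduced density matrix of the first factor, `tr₂ |g⟩⟨g|`. -/
def reducedLeft {α β : Type*} [Fintype β] (g : α × β → ℂ) : Matrix α α ℂ :=
  Matrix.of fun c d => ∑ e, g (c, e) * star (g (d, e))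

/-- Reduced density matrix of the second factor, `tr₁ |g⟩⟨g|`. -/
def reducedRight {α β : Type*} [Fintype α] (g : α × β → ℂ) : Matrix β β ℂ :=
  Matrix.of fun c d => ∑ e, g (e, c) * star (g (e, d))

theorem reducedLeft_isHermitian {α β : Type*} [Fintype β] (g : α × β → ℂ) :
    (reducedLeft g).IsHermitian := by
  ext c d
  simp [reducedLeft, mul_comm]

theorem reducedRight_isHermitian {α β : Type*} [Fintype α] (g : α × β → ℂ) :
    (reducedRight g).IsHermitian := by
  ext c d
  simp [reducedRight, mul_comm]

/-- Entanglement entropy `S(ρ_L)` of the first factor in the pure state `g`. -/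
def entropyLeft {α β : Type*} [Fintype α] [Fintype β] [DecidableEq α]
    (g : α × β → ℂ) : ℝ :=
  entropy (reducedLeft g) (reducedLeft_isHermitian g)

/-- Entanglement entropy `S(ρ_R)` of the second factor in the pure state `g`. -/
def entropyRight {α β : Type*} [Fintype α] [Fintype β] [DecidableEq β]
    (g : α × β → ℂ) : ℝ :=
  entropy (reducedRight g) (reducedRight_isHermitian g)

end Reduced

end TwoRing

end

/-! The quadratic form of the Hamiltonian is a sum of squares plus the self-energy of the holes
(`form_eq`), and no term connects different numbers of holes of either ring (`density_restrict`).
The sectors can therefore be treated separately.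

With one hole in each ring the self-energy vanishes. Transporting both holes to site 1 turns a state
into a vector field on the N × N grid of hole positions. Hopping becomes the Dirichlet energy of the
grid; the joint hop glues two opposite corners with a twist T that rotates the other N - 1 sites;
away from two sides of the grid, H_P asks for a singlet on the first pair after the holes (projector
P). The resistance between opposite corners of the grid is O(log N), so a field of energy E has a
corner value v with ‖v - PTv‖² = O(E log N). After N - 1 applications of PT every pair has been
projected onto a singlet (`exists_rotor_pow_eq`), so v is close to a multiple of one fixed vector.
The iteration costs N² and the sum over the grid another N²; this is the N⁴ log N of
`sum_norm_sub_iterate_sq_le`.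

In every other sector some ring has no hole, which costs V₁, or at least two, which costs at least
as much by a Hardy-type inequality (`sum_weight_ge`, `sum_ringEnergy_ge`).

The ground state has energy 0: both holes are uniformly spread and N - 1 singlets are carried along.
Different hole positions are orthogonal, so the reduced density matrix is 2^-(N-1) times a projector
and the entropy is exactly N - 1. A state without holes has energy 2 V₁; this bounds the gap from
above and makes -log Δ at least 3 log N, which absorbs the logarithm when the entropy is expressed
through Δ. -/

noncomputable section

namespace TwoRing

/-! ### Effective resistance and Poincaré inequality on the square grid. -/

section Grid

variable {W : Type*} [NormedAddCommGroup W]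

theorem norm_sq_sub_le (x y z : W) : ‖x - z‖ ^ 2 ≤ 2 * ‖x - y‖ ^ 2 + 2 * ‖y - z‖ ^ 2 := by
  have h := norm_sub_le_norm_sub_add_norm_sub x y z
  nlinarith [norm_nonneg (x - z), norm_nonneg (x - y), norm_nonneg (y - z),
    sq_nonneg (‖x - y‖ - ‖y - z‖)]

theorem norm_sq_add_le (x y : W) : ‖x + y‖ ^ 2 ≤ 2 * ‖x‖ ^ 2 + 2 * ‖y‖ ^ 2 := by
  have h := norm_add_le x y
  nlinarith [norm_nonneg (x + y), norm_nonneg x, norm_nonneg y, sq_nonneg (‖x‖ - ‖y‖)]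

/-- Telescoping and Cauchy–Schwarz over at most N steps. -/
theorem norm_sub_sq_le_path (h : ℕ → W) {N i l : ℕ} (hi : i < N) (hl : l < N) :
    ‖h i - h l‖ ^ 2 ≤ N * ∑ t ∈ Finset.range (N - 1), ‖h (t + 1) - h t‖ ^ 2 := by
  wlog hil : l ≤ i generalizing i l with H
  · rw [norm_sub_rev]
    exact H hl hi (by omega)
  have h1 : ‖h i - h l‖ ≤ ∑ t ∈ Finset.Ico l i, ‖h (t + 1) - h t‖ := by
    rw [← Finset.sum_Ico_sub h hil]
    exact norm_sum_le _ _
  have h2 : (∑ t ∈ Finset.Ico l i, ‖h (t + 1) - h t‖) ^ 2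
      ≤ (Finset.Ico l i).card * ∑ t ∈ Finset.Ico l i, ‖h (t + 1) - h t‖ ^ 2 :=
    sq_sum_le_card_mul_sum_sq
  have h3 : ∑ t ∈ Finset.Ico l i, ‖h (t + 1) - h t‖ ^ 2
      ≤ ∑ t ∈ Finset.range (N - 1), ‖h (t + 1) - h t‖ ^ 2 := by
    apply Finset.sum_le_sum_of_subset_of_nonneg
    · intro t ht
      simp only [Finset.mem_Ico, Finset.mem_range] at *
      omega
    · intros; positivity
  have h4 : ((Finset.Ico l i).card : ℝ) ≤ N := by
    simp only [Nat.card_Ico]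
    exact_mod_cast (by omega : i - l ≤ N)
  calc ‖h i - h l‖ ^ 2 ≤ (∑ t ∈ Finset.Ico l i, ‖h (t + 1) - h t‖) ^ 2 := by gcongr
    _ ≤ _ := h2
    _ ≤ _ := by gcongr

/-- Dirichlet form of a function on the `N × N` grid. -/
noncomputable def gridEnergy (N : ℕ) (f : ℕ → ℕ → W) : ℝ :=
  ∑ k ∈ Finset.range (N - 1), ∑ l ∈ Finset.range N, ‖f (k + 1) l - f k l‖ ^ 2
    + ∑ k ∈ Finset.range N, ∑ l ∈ Finset.range (N - 1), ‖f k (l + 1) - f k l‖ ^ 2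

theorem gridEnergy_nonneg (N : ℕ) (f : ℕ → ℕ → W) : 0 ≤ gridEnergy N f := by
  unfold gridEnergy; positivity

theorem gridEnergy_reflect (N : ℕ) (f : ℕ → ℕ → W) :
    gridEnergy N (fun k l => f (N - 1 - k) (N - 1 - l)) = gridEnergy N f := by
  unfold gridEnergy
  congr 1
  · rw [← Finset.sum_range_reflect (fun k => ∑ l ∈ Finset.range N, ‖f (k + 1) l - f k l‖ ^ 2)]
    refine Finset.sum_congr rfl fun k hk => ?_
    rw [← Finset.sum_range_reflect (fun l => ‖f (N - 1 - 1 - k + 1) l - f (N - 1 - 1 - k) l‖ ^ 2)]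
    refine Finset.sum_congr rfl fun l hl => ?_
    rw [Finset.mem_range] at hk
    beta_reduce
    rw [show N - 1 - 1 - k + 1 = N - 1 - k by omega, show N - 1 - (k + 1) = N - 1 - 1 - k by omega,
      norm_sub_rev]
  · rw [← Finset.sum_range_reflect
      (fun k => ∑ l ∈ Finset.range (N - 1), ‖f k (l + 1) - f k l‖ ^ 2)]
    refine Finset.sum_congr rfl fun k hk => ?_
    rw [← Finset.sum_range_reflect (fun l => ‖f (N - 1 - k) (l + 1) - f (N - 1 - k) l‖ ^ 2)]
    refine Finset.sum_congr rfl fun l hl => ?_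
    rw [Finset.mem_range] at hl
    beta_reduce
    rw [show N - 1 - 1 - l + 1 = N - 1 - l by omega, show N - 1 - (l + 1) = N - 1 - 1 - l by omega,
      norm_sub_rev]

variable [NormedSpace ℝ W]

theorem norm_sq_sum_smul_le {ι : Type*} (s : Finset ι) (w : ι → ℝ) (x : ι → W) :
    ‖∑ i ∈ s, w i • x i‖ ^ 2 ≤ (∑ i ∈ s, w i ^ 2) * ∑ i ∈ s, ‖x i‖ ^ 2 := by
  have h1 : ‖∑ i ∈ s, w i • x i‖ ≤ ∑ i ∈ s, |w i| * ‖x i‖ := by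
    refine (norm_sum_le _ _).trans (le_of_eq ?_)
    simp [norm_smul]
  calc ‖∑ i ∈ s, w i • x i‖ ^ 2 ≤ (∑ i ∈ s, |w i| * ‖x i‖) ^ 2 := by gcongr
    _ ≤ (∑ i ∈ s, |w i| ^ 2) * ∑ i ∈ s, ‖x i‖ ^ 2 := Finset.sum_mul_sq_le_sq_mul_sq _ _ _
    _ = _ := by simp

/-- Average of a function over the antidiagonal `i + j = r`. -/
noncomputable def diagAvg (f : ℕ → ℕ → W) (r : ℕ) : W :=
  ((r : ℝ) + 1)⁻¹ • ∑ p ∈ Finset.HasAntidiagonal.antidiagonal r, f p.1 p.2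

/-- Pólya urn flow from one antidiagonal to the next. -/
theorem diagAvg_succ_sub (f : ℕ → ℕ → W) (r : ℕ) :
    diagAvg f (r + 1) - diagAvg f r = ∑ p ∈ Finset.HasAntidiagonal.antidiagonal r,
      ((((p.1 : ℝ) + 1) / (((r : ℝ) + 1) * (r + 2))) • (f (p.1 + 1) p.2 - f p.1 p.2)
        + (((p.2 : ℝ) + 1) / (((r : ℝ) + 1) * (r + 2))) • (f p.1 (p.2 + 1) - f p.1 p.2)) := by
  have hr1 : (r : ℝ) + 1 ≠ 0 := by positivity
  have hr2 : (r : ℝ) + 2 ≠ 0 := by positivity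
  -- From (i, j) the flow sends weight i + 1 in the first direction and j + 1 in the second. The
  -- outgoing weights add up to r + 2 at every point and the incoming ones, at the next
  -- antidiagonal, to r + 1; so uniform mass goes to uniform mass.
  have e1 : ∑ p ∈ Finset.HasAntidiagonal.antidiagonal r, ((p.1 : ℝ) + 1) • f (p.1 + 1) p.2
      = ∑ p ∈ Finset.HasAntidiagonal.antidiagonal (r + 1), (p.1 : ℝ) • f p.1 p.2 := by
    rw [Finset.Nat.sum_antidiagonal_succ]
    simp
  have e2 : ∑ p ∈ Finset.HasAntidiagonal.antidiagonal r, ((p.2 : ℝ) + 1) • f p.1 (p.2 + 1)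
      = ∑ p ∈ Finset.HasAntidiagonal.antidiagonal (r + 1), (p.2 : ℝ) • f p.1 p.2 := by
    rw [Finset.Nat.sum_antidiagonal_succ']
    simp
  have e3 : ∑ p ∈ Finset.HasAntidiagonal.antidiagonal (r + 1), (p.1 : ℝ) • f p.1 p.2
      + ∑ p ∈ Finset.HasAntidiagonal.antidiagonal (r + 1), (p.2 : ℝ) • f p.1 p.2
      = ((r : ℝ) + 1) • ∑ p ∈ Finset.HasAntidiagonal.antidiagonal (r + 1), f p.1 p.2 := by
    rw [← Finset.sum_add_distrib, Finset.smul_sum]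
    refine Finset.sum_congr rfl fun p hp => ?_
    rw [← add_smul]
    congr 1
    rw [Finset.HasAntidiagonal.mem_antidiagonal] at hp
    exact_mod_cast hp
  have e4 : ∑ p ∈ Finset.HasAntidiagonal.antidiagonal r, (((p.1 : ℝ) + 1) • f p.1 p.2 + ((p.2 : ℝ) + 1) • f p.1 p.2)
      = ((r : ℝ) + 2) • ∑ p ∈ Finset.HasAntidiagonal.antidiagonal r, f p.1 p.2 := by
    rw [Finset.smul_sum]
    refine Finset.sum_congr rfl fun p hp => ?_
    rw [← add_smul]
    congr 1
    rw [Finset.HasAntidiagonal.mem_antidiagonal] at hp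
    have : (p.1 : ℝ) + p.2 = r := by exact_mod_cast hp
    linarith
  have key : (((r : ℝ) + 1) * (r + 2)) • (diagAvg f (r + 1) - diagAvg f r)
      = ∑ p ∈ Finset.HasAntidiagonal.antidiagonal r,
        (((p.1 : ℝ) + 1) • (f (p.1 + 1) p.2 - f p.1 p.2)
          + ((p.2 : ℝ) + 1) • (f p.1 (p.2 + 1) - f p.1 p.2)) := by
    have : ∀ p : ℕ × ℕ, (((p.1 : ℝ) + 1) • (f (p.1 + 1) p.2 - f p.1 p.2)
          + ((p.2 : ℝ) + 1) • (f p.1 (p.2 + 1) - f p.1 p.2))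
        = ((((p.1 : ℝ) + 1) • f (p.1 + 1) p.2) + (((p.2 : ℝ) + 1) • f p.1 (p.2 + 1)))
          - (((p.1 : ℝ) + 1) • f p.1 p.2 + ((p.2 : ℝ) + 1) • f p.1 p.2) := by
      intro p
      rw [smul_sub, smul_sub]
      abel
    simp_rw [this]
    rw [Finset.sum_sub_distrib, Finset.sum_add_distrib, e1, e2, e3, e4]
    unfold diagAvg
    rw [smul_sub, smul_smul, smul_smul]
    congr 2
    · push_cast
      field_simp
      ring
    · field_simp
  have h : diagAvg f (r + 1) - diagAvg f r = (((r : ℝ) + 1) * (r + 2))⁻¹ •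
      ((((r : ℝ) + 1) * (r + 2)) • (diagAvg f (r + 1) - diagAvg f r)) := by
    rw [smul_smul, inv_mul_cancel₀ (mul_ne_zero hr1 hr2), one_smul]
  rw [h, key, Finset.smul_sum]
  refine Finset.sum_congr rfl fun p _ => ?_
  rw [smul_add, smul_smul, smul_smul, div_eq_inv_mul, div_eq_inv_mul]

/-- Cauchy–Schwarz against the flow: since (i + 1)² + (j + 1)² ≤ (r + 1)(r + 2) for i + j = r, each
of the r + 1 points contributes at most 1/((r + 1)(r + 2)) to the energy of the flow. -/
theorem norm_diagAvg_succ_sub_sq (f : ℕ → ℕ → W) (r : ℕ) :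
    ‖diagAvg f (r + 1) - diagAvg f r‖ ^ 2 ≤ ((r : ℝ) + 2)⁻¹ * ∑ p ∈ Finset.HasAntidiagonal.antidiagonal r,
      (‖f (p.1 + 1) p.2 - f p.1 p.2‖ ^ 2 + ‖f p.1 (p.2 + 1) - f p.1 p.2‖ ^ 2) := by
  rw [diagAvg_succ_sub]
  have h := norm_sq_sum_smul_le (Finset.HasAntidiagonal.antidiagonal r ×ˢ (Finset.univ : Finset Bool))
    (fun q => if q.2 then ((q.1.1 : ℝ) + 1) / (((r : ℝ) + 1) * (r + 2))
      else ((q.1.2 : ℝ) + 1) / (((r : ℝ) + 1) * (r + 2)))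
    (fun q => if q.2 then f (q.1.1 + 1) q.1.2 - f q.1.1 q.1.2
      else f q.1.1 (q.1.2 + 1) - f q.1.1 q.1.2)
  simp only [Finset.sum_product, Fintype.sum_bool, if_true, Bool.false_eq_true, if_false] at h
  refine h.trans ?_
  gcongr
  have hr1 : (0 : ℝ) < (r : ℝ) + 1 := by positivity
  have hr2 : (0 : ℝ) < (r : ℝ) + 2 := by positivity
  have : ∀ p ∈ Finset.HasAntidiagonal.antidiagonal r, (((p.1 : ℝ) + 1) / (((r : ℝ) + 1) * (r + 2))) ^ 2
      + (((p.2 : ℝ) + 1) / (((r : ℝ) + 1) * (r + 2))) ^ 2 ≤ (((r : ℝ) + 1) * (r + 2))⁻¹ := by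
    intro p hp
    rw [Finset.HasAntidiagonal.mem_antidiagonal] at hp
    have hp' : (p.1 : ℝ) + p.2 = r := by exact_mod_cast hp
    have h1 : (0 : ℝ) ≤ p.1 := by positivity
    have h2 : (0 : ℝ) ≤ p.2 := by positivity
    rw [div_pow, div_pow, ← add_div, div_le_iff₀ (by positivity)]
    rw [inv_mul_eq_div, le_div_iff₀ (by positivity)]
    rw [← hp']
    nlinarith [mul_nonneg h1 h2, mul_nonneg (mul_nonneg h1 h2) h1, mul_nonneg (mul_nonneg h1 h2) h2,
      mul_nonneg (mul_nonneg h1 h2) (mul_nonneg h1 h2)]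
  refine (Finset.sum_le_sum this).trans (le_of_eq ?_)
  rw [Finset.sum_const, Finset.Nat.card_antidiagonal, nsmul_eq_mul]
  push_cast
  field_simp

theorem sum_antidiagonal_le (N : ℕ) (φ : ℕ → ℕ → ℝ) (hφ : ∀ i j, 0 ≤ φ i j) {a b : ℕ}
    (ha : N ≤ a) (hb : N ≤ b) :
    ∑ r ∈ Finset.range N, ∑ p ∈ Finset.HasAntidiagonal.antidiagonal r, φ p.1 p.2
      ≤ ∑ i ∈ Finset.range a, ∑ j ∈ Finset.range b, φ i j := by
  simp_rw [Finset.Nat.sum_antidiagonal_eq_sum_range_succ]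
  rw [Finset.sum_range_diag_flip]
  refine (Finset.sum_le_sum (g := fun i => ∑ j ∈ Finset.range b, φ i j) fun i _ => ?_).trans ?_
  · refine Finset.sum_le_sum_of_subset_of_nonneg ?_ fun _ _ _ => hφ _ _
    exact Finset.range_mono (by omega)
  · refine Finset.sum_le_sum_of_subset_of_nonneg (Finset.range_mono ha) fun i _ _ => ?_
    exact Finset.sum_nonneg fun _ _ => hφ _ _

/-- The sum is the N-th harmonic number without its first term 1, which cancels the 1 in the
standard bound. -/
theorem sum_inv_le_log {N : ℕ} (hN : 1 ≤ N) :
    ∑ r ∈ Finset.range (N - 1), ((r : ℝ) + 2)⁻¹ ≤ Real.log N := by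
  have h := harmonic_le_one_add_log N
  obtain ⟨n, rfl⟩ : ∃ n, N = n + 1 := ⟨N - 1, by omega⟩
  rw [harmonic, Finset.sum_range_succ'] at h
  push_cast at h
  simp only [Nat.add_sub_cancel]
  push_cast
  have : ∀ r : ℕ, ((r : ℝ) + 2)⁻¹ = ((r : ℝ) + 1 + 1)⁻¹ := by intro r; congr 1; ring
  simp_rw [this]
  norm_num at h
  linarith

/-- Thomson's principle: the layers of the flow act as resistances 1/(r + 2) in series between the
corner and the main antidiagonal. -/
theorem norm_diagAvg_sub_corner_sq (f : ℕ → ℕ → W) {N : ℕ} (hN : 1 ≤ N) :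
    ‖diagAvg f (N - 1) - f 0 0‖ ^ 2 ≤ Real.log N * gridEnergy N f := by
  have h0 : diagAvg f 0 = f 0 0 := by simp [diagAvg]
  rw [← h0, ← Finset.sum_range_sub]
  have h1 : ‖∑ i ∈ Finset.range (N - 1), (diagAvg f (i + 1) - diagAvg f i)‖ ^ 2
      ≤ (∑ i ∈ Finset.range (N - 1), ‖diagAvg f (i + 1) - diagAvg f i‖) ^ 2 := by
    gcongr
    exact norm_sum_le _ _
  refine h1.trans ?_
  have h2 := Finset.sum_sq_le_sum_mul_sum_of_sq_le_mul (Finset.range (N - 1))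
    (r := fun i => ‖diagAvg f (i + 1) - diagAvg f i‖)
    (f := fun i : ℕ => ((i : ℝ) + 2)⁻¹)
    (g := fun i => ∑ p ∈ Finset.HasAntidiagonal.antidiagonal i,
      (‖f (p.1 + 1) p.2 - f p.1 p.2‖ ^ 2 + ‖f p.1 (p.2 + 1) - f p.1 p.2‖ ^ 2))
    (fun i _ => by positivity) (fun i _ => by positivity)
    (fun i _ => norm_diagAvg_succ_sub_sq f i)
  refine h2.trans ?_
  have h3 := sum_inv_le_log hN
  have h4 : ∑ i ∈ Finset.range (N - 1), ∑ p ∈ Finset.HasAntidiagonal.antidiagonal i,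
      (‖f (p.1 + 1) p.2 - f p.1 p.2‖ ^ 2 + ‖f p.1 (p.2 + 1) - f p.1 p.2‖ ^ 2)
      ≤ gridEnergy N f := by
    simp_rw [Finset.sum_add_distrib]
    unfold gridEnergy
    refine add_le_add ?_ ?_
    · exact sum_antidiagonal_le (N - 1) (fun i j => ‖f (i + 1) j - f i j‖ ^ 2)
        (fun _ _ => by positivity) le_rfl (Nat.sub_le N 1)
    · exact sum_antidiagonal_le (N - 1) (fun i j => ‖f i (j + 1) - f i j‖ ^ 2)
        (fun _ _ => by positivity) (Nat.sub_le N 1) le_rfl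
  have : 0 ≤ Real.log N := Real.log_natCast_nonneg N
  gcongr

/-- For r = N - 1 the point reflection of the grid preserves the main antidiagonal and exchanges the
two corners, so both corners are compared with the same average. -/
theorem diagAvg_reflect (f : ℕ → ℕ → W) (r : ℕ) :
    diagAvg (fun k l => f (r - k) (r - l)) r = diagAvg f r := by
  unfold diagAvg
  congr 1
  rw [← Finset.Nat.sum_antidiagonal_swap]
  refine Finset.sum_congr rfl fun p hp => ?_
  rw [Finset.HasAntidiagonal.mem_antidiagonal] at hp
  beta_reduce
  rw [Prod.fst_swap, Prod.snd_swap, show r - p.2 = p.1 by omega, show r - p.1 = p.2 by omega]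

theorem norm_diagAvg_sub_far_corner_sq (f : ℕ → ℕ → W) {N : ℕ} (hN : 1 ≤ N) :
    ‖diagAvg f (N - 1) - f (N - 1) (N - 1)‖ ^ 2 ≤ Real.log N * gridEnergy N f := by
  have h := norm_diagAvg_sub_corner_sq (fun k l => f (N - 1 - k) (N - 1 - l)) hN
  rw [diagAvg_reflect, gridEnergy_reflect] at h
  simpa using h

theorem norm_sub_diagAvg_sq_le (f : ℕ → ℕ → W) (r : ℕ) (x : W) :
    ‖x - diagAvg f r‖ ^ 2
      ≤ ((r : ℝ) + 1)⁻¹ * ∑ p ∈ Finset.HasAntidiagonal.antidiagonal r, ‖x - f p.1 p.2‖ ^ 2 := by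
  have hr : (r : ℝ) + 1 ≠ 0 := by positivity
  have h : x - diagAvg f r = ∑ p ∈ Finset.HasAntidiagonal.antidiagonal r, ((r : ℝ) + 1)⁻¹ • (x - f p.1 p.2) := by
    rw [← Finset.smul_sum, Finset.sum_sub_distrib, smul_sub, Finset.sum_const,
      Finset.Nat.card_antidiagonal, ← Nat.cast_smul_eq_nsmul ℝ, smul_smul]
    push_cast
    rw [inv_mul_cancel₀ hr, one_smul, diagAvg]
  rw [h]
  refine (norm_sq_sum_smul_le _ _ _).trans (le_of_eq ?_)
  rw [Finset.sum_const, Finset.Nat.card_antidiagonal, nsmul_eq_mul]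
  push_cast
  field_simp

/-- Each (k, l) is joined to each antidiagonal point (i, N - 1 - i) through (i, l), along one
straight segment in each direction. No logarithm appears: it is only the price of pointwise values
at the corners. -/
theorem sum_norm_sub_diagAvg_sq (f : ℕ → ℕ → W) {N : ℕ} (hN : 1 ≤ N) :
    ∑ k ∈ Finset.range N, ∑ l ∈ Finset.range N, ‖f k l - diagAvg f (N - 1)‖ ^ 2
      ≤ 2 * (N : ℝ) ^ 2 * gridEnergy N f := by
  have hN' : ((N - 1 : ℕ) : ℝ) + 1 = N := by
    exact_mod_cast (by omega : N - 1 + 1 = N)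
  have hN0 : (N : ℝ) ≠ 0 := by positivity
  set X : ℕ → ℝ := fun l => ∑ k ∈ Finset.range (N - 1), ‖f (k + 1) l - f k l‖ ^ 2 with hX
  set Y : ℕ → ℝ := fun k => ∑ l ∈ Finset.range (N - 1), ‖f k (l + 1) - f k l‖ ^ 2 with hY
  have hE : gridEnergy N f = ∑ l ∈ Finset.range N, X l + ∑ k ∈ Finset.range N, Y k := by
    unfold gridEnergy
    rw [Finset.sum_comm]
  have hpt : ∀ k ∈ Finset.range N, ∀ l ∈ Finset.range N,
      ‖f k l - diagAvg f (N - 1)‖ ^ 2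
        ≤ (N : ℝ)⁻¹ * ∑ i ∈ Finset.range N, (2 * (N * X l) + 2 * (N * Y i)) := by
    intro k hk l hl
    refine (norm_sub_diagAvg_sq_le f (N - 1) (f k l)).trans ?_
    rw [hN', Finset.Nat.sum_antidiagonal_eq_sum_range_succ_mk, show (N - 1).succ = N by omega]
    gcongr with i hi
    rw [Finset.mem_range] at hk hl hi
    have h1 := norm_sub_sq_le_path (fun t => f t l) hk hi
    have h2 := norm_sub_sq_le_path (fun t => f i t) hl (show N - 1 - i < N by omega)
    have h3 := norm_sq_sub_le (f k l) (f i l) (f i (N - 1 - i))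
    simp only [hX, hY]
    linarith
  refine (Finset.sum_le_sum fun k hk => Finset.sum_le_sum fun l hl => hpt k hk l hl).trans
    (le_of_eq ?_)
  rw [hE]
  simp only [Finset.sum_add_distrib, Finset.sum_const, Finset.card_range, nsmul_eq_mul,
    ← Finset.mul_sum, mul_add]
  field_simp

end Grid

/-! ### From small energy to near invariance under the rotation. -/

section Rotation

variable {W : Type*} [NormedAddCommGroup W] [NormedSpace ℂ W]

theorem norm_sub_iterate_le (K : W →ₗ[ℂ] W) (hK : ∀ x, ‖K x‖ ≤ ‖x‖) (v : W) (n : ℕ) :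
    ‖v - (K ^ n) v‖ ≤ n * ‖v - K v‖ := by
  induction n with
  | zero => simp
  | succ n ih =>
    have h1 : v - (K ^ (n + 1)) v = (v - K v) + K (v - (K ^ n) v) := by
      rw [pow_succ', Module.End.mul_apply, map_sub]
      abel
    rw [h1]
    refine (norm_add_le _ _).trans ?_
    have := hK (v - (K ^ n) v)
    push_cast
    linarith

/-- If `f` is a field on the `N × N` grid, `T` identifies its far corner with its near corner and
`P` is a local constraint, then `f` is close to `(P T)^(N-1)` applied to its corner value, with an
error controlled by the energy. -/
theorem sum_norm_sub_iterate_sq_le (P T : W →ₗ[ℂ] W) (hP : ∀ x, ‖P x‖ ≤ ‖x‖)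
    (hT : ∀ x, ‖T x‖ ≤ ‖x‖) {N : ℕ} (hN : 2 ≤ N) (f : ℕ → ℕ → W) (E : ℝ)
    (hE : gridEnergy N f + ‖f 0 0 - T (f (N - 1) (N - 1))‖ ^ 2
      + ∑ k ∈ Finset.range (N - 1), ∑ l ∈ Finset.range (N - 1),
        ‖f (k + 1) (l + 1) - P (f (k + 1) (l + 1))‖ ^ 2 ≤ E) :
    ∑ k ∈ Finset.range N, ∑ l ∈ Finset.range N, ‖f k l - ((P * T) ^ (N - 1)) (f 0 0)‖ ^ 2
      ≤ 4000 * ((N : ℝ) ^ 4 * Real.log N) * E := by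
  let _ : NormedSpace ℝ W := NormedSpace.restrictScalars ℝ ℂ W
  set v := f 0 0
  set u := f (N - 1) (N - 1)
  set A := diagAvg f (N - 1)
  set D := gridEnergy N f
  set H := Real.log N
  set EP := ∑ k ∈ Finset.range (N - 1), ∑ l ∈ Finset.range (N - 1),
        ‖f (k + 1) (l + 1) - P (f (k + 1) (l + 1))‖ ^ 2
  have hN2 : (2 : ℝ) ≤ N := by exact_mod_cast hN
  have hD : 0 ≤ D := gridEnergy_nonneg N f
  have hEP : 0 ≤ EP := by positivity
  have hH : (1 : ℝ) / 2 ≤ H := by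
    have h1 : Real.log 2 ≤ Real.log N := Real.log_le_log (by norm_num) hN2
    have := Real.log_two_gt_d9
    norm_num at *
    linarith
  have hB : 0 ≤ ‖v - T u‖ ^ 2 := by positivity
  have hDE : D ≤ E := by linarith
  have hE0 : 0 ≤ E := hD.trans hDE
  have h1 : ‖A - v‖ ^ 2 ≤ H * D := norm_diagAvg_sub_corner_sq f (by omega)
  have h2 : ‖A - u‖ ^ 2 ≤ H * D := norm_diagAvg_sub_far_corner_sq f (by omega)
  have h3 : ∑ k ∈ Finset.range N, ∑ l ∈ Finset.range N, ‖f k l - A‖ ^ 2 ≤ 2 * (N : ℝ) ^ 2 * D :=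
    sum_norm_sub_diagAvg_sq f (by omega)
  have hHD : H * D ≤ H * E := by gcongr
  have h4 : ∑ k ∈ Finset.range N, ∑ l ∈ Finset.range N, ‖f k l - v‖ ^ 2
      ≤ 10 * (N : ℝ) ^ 2 * (H * E) := by
    have : ∀ k ∈ Finset.range N, ∀ l ∈ Finset.range N,
        ‖f k l - v‖ ^ 2 ≤ 2 * ‖f k l - A‖ ^ 2 + 2 * (H * D) := by
      intro k _ l _
      have := norm_sq_sub_le (f k l) A v
      linarith
    refine (Finset.sum_le_sum fun k hk => Finset.sum_le_sum fun l hl => this k hk l hl).trans ?_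
    simp only [Finset.sum_add_distrib, Finset.sum_const, Finset.card_range, nsmul_eq_mul,
      ← Finset.mul_sum]
    have hD2 : D ≤ 2 * (H * E) := by nlinarith
    nlinarith [sq_nonneg (N : ℝ)]
  have hQ : ∀ x, ‖x - P x‖ ≤ 2 * ‖x‖ := by
    intro x
    have := norm_sub_le x (P x)
    linarith [hP x]
  -- The constraint is imposed at (N - 1)² ≥ N²/4 points, where the field is close to v on average;
  -- averaging over them loses no power of N. The constant absorbs (80 N² + 4)/(N²/4) ≤ 324.
  have h5 : ‖v - P v‖ ^ 2 ≤ 340 * (H * E) := by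
    have hpt : ∀ k ∈ Finset.range (N - 1), ∀ l ∈ Finset.range (N - 1),
        ‖v - P v‖ ^ 2 ≤ 8 * ‖f (k + 1) (l + 1) - v‖ ^ 2
          + 2 * ‖f (k + 1) (l + 1) - P (f (k + 1) (l + 1))‖ ^ 2 := by
      intro k _ l _
      set y := f (k + 1) (l + 1)
      have e : v - P v = (y - P y) - ((y - v) - P (y - v)) := by
        rw [map_sub]; abel
      have e2 := norm_sq_add_le (y - P y) (-((y - v) - P (y - v)))
      rw [← sub_eq_add_neg, ← e, norm_neg] at e2
      have e3 := hQ (y - v)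
      have e4 : ‖(y - v) - P (y - v)‖ ^ 2 ≤ (2 * ‖y - v‖) ^ 2 := by gcongr
      nlinarith
    have hs := Finset.sum_le_sum fun k hk => Finset.sum_le_sum fun l hl => hpt k hk l hl
    simp only [Finset.sum_add_distrib, Finset.sum_const, Finset.card_range, nsmul_eq_mul,
      ← Finset.mul_sum] at hs
    have hsub : ∑ k ∈ Finset.range (N - 1), ∑ l ∈ Finset.range (N - 1), ‖f (k + 1) (l + 1) - v‖ ^ 2
        ≤ ∑ k ∈ Finset.range N, ∑ l ∈ Finset.range N, ‖f k l - v‖ ^ 2 := by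
      obtain ⟨n, rfl⟩ : ∃ n, N = n + 1 := ⟨N - 1, by omega⟩
      simp only [Nat.add_sub_cancel]
      rw [Finset.sum_range_succ']
      refine le_add_of_le_of_nonneg (Finset.sum_le_sum fun k _ => ?_) (by positivity)
      rw [Finset.sum_range_succ']
      exact le_add_of_nonneg_right (by positivity)
    have hc : ((N - 1 : ℕ) : ℝ) = N - 1 := by
      rw [Nat.cast_sub (by omega)]; simp
    rw [hc] at hs
    have hEPE : EP ≤ 2 * (H * E) := by nlinarith
    have hq : 0 ≤ ‖v - P v‖ ^ 2 := by positivity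
    have hHE : 0 ≤ H * E := by positivity
    have hNq : (N : ℝ) ^ 2 / 4 * ‖v - P v‖ ^ 2 ≤ 80 * (N : ℝ) ^ 2 * (H * E) + 4 * (H * E) := by
      have : (N : ℝ) ^ 2 / 4 ≤ (N - 1) * (N - 1) := by nlinarith
      have h' := mul_le_mul_of_nonneg_right this hq
      linarith
    have hN4 : (4 : ℝ) ≤ (N : ℝ) ^ 2 := by nlinarith
    have : (N : ℝ) ^ 2 / 4 * ‖v - P v‖ ^ 2 ≤ (N : ℝ) ^ 2 / 4 * (340 * (H * E)) := by nlinarith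
    exact le_of_mul_le_mul_left this (by positivity)
  -- The glued bond compares v with T u, and u is close to v through the antidiagonal average A.
  have h6 : ‖v - T v‖ ^ 2 ≤ 12 * (H * E) := by
    have e1 := norm_sq_sub_le v (T u) (T v)
    have e2 : ‖T u - T v‖ ^ 2 ≤ ‖u - v‖ ^ 2 := by
      rw [← map_sub]; gcongr; exact hT _
    have e3 := norm_sq_sub_le u A v
    rw [norm_sub_rev u A] at e3
    have : ‖v - T u‖ ^ 2 ≤ 2 * (H * E) := by nlinarith
    linarith
  have h7 : ‖v - (P * T) v‖ ^ 2 ≤ 704 * (H * E) := by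
    have e : v - (P * T) v = (v - P v) + P (v - T v) := by
      rw [Module.End.mul_apply, map_sub]; abel
    rw [e]
    have e1 := norm_sq_add_le (v - P v) (P (v - T v))
    have e2 : ‖P (v - T v)‖ ^ 2 ≤ ‖v - T v‖ ^ 2 := by gcongr; exact hP _
    linarith
  have hK : ∀ x, ‖(P * T) x‖ ≤ ‖x‖ := fun x => (hP _).trans (hT _)
  -- Errors of a contraction add up linearly, hence N² for the square; summing over the N² grid
  -- points gives the final N⁴.
  have h8 : ‖v - ((P * T) ^ (N - 1)) v‖ ^ 2 ≤ (N : ℝ) ^ 2 * (704 * (H * E)) := by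
    have e := norm_sub_iterate_le (P * T) hK v (N - 1)
    have hc : ((N - 1 : ℕ) : ℝ) ≤ N := by exact_mod_cast Nat.sub_le _ _
    calc ‖v - ((P * T) ^ (N - 1)) v‖ ^ 2 ≤ (((N - 1 : ℕ) : ℝ) * ‖v - (P * T) v‖) ^ 2 := by gcongr
      _ ≤ (N * ‖v - (P * T) v‖) ^ 2 := by gcongr
      _ = (N : ℝ) ^ 2 * ‖v - (P * T) v‖ ^ 2 := by ring
      _ ≤ _ := by gcongr
  set w := ((P * T) ^ (N - 1)) v
  have hfin : ∀ k ∈ Finset.range N, ∀ l ∈ Finset.range N,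
      ‖f k l - w‖ ^ 2 ≤ 2 * ‖f k l - v‖ ^ 2 + 2 * ((N : ℝ) ^ 2 * (704 * (H * E))) := by
    intro k _ l _
    have := norm_sq_sub_le (f k l) v w
    linarith
  refine (Finset.sum_le_sum fun k hk => Finset.sum_le_sum fun l hl => hfin k hk l hl).trans ?_
  simp only [Finset.sum_add_distrib, Finset.sum_const, Finset.card_range, nsmul_eq_mul,
    ← Finset.mul_sum]
  have hHE : 0 ≤ H * E := by positivity
  have hN4 : (N : ℝ) ^ 2 ≤ (N : ℝ) ^ 4 := pow_le_pow_right₀ (by linarith) (by norm_num)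
  have := mul_le_mul_of_nonneg_right hN4 hHE
  nlinarith [mul_nonneg (by positivity : (0 : ℝ) ≤ (N : ℝ) ^ 4) hHE]

end Rotation

open Matrix

/-! ### Quadratic forms of matching Laplacians and of projectors. -/

section Generic

variable {X : Type*}

theorem kronecker_isHermitian {A B : Matrix X X ℂ} (hA : A.IsHermitian) (hB : B.IsHermitian) :
    (A ⊗ₖ B).IsHermitian := by
  rw [IsHermitian, conjTranspose_kronecker, hA.eq, hB.eq]

variable [Fintype X]

theorem star_dotProduct_self (v : X → ℂ) : star v ⬝ᵥ v = ((∑ x, ‖v x‖ ^ 2 : ℝ) : ℂ) := by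
  rw [dotProduct]
  push_cast
  refine Finset.sum_congr rfl fun x _ => ?_
  rw [Pi.star_apply, ← starRingEnd_apply, Complex.conj_mul']

/-- The form of the Laplacian of a matching, restricted to the edges issued from `A`. -/
theorem edge_form (π : X → X) (hπ : ∀ x, π (π x) = x) (A : X → Prop) [DecidablePred A]
    (ψ : X → ℂ) :
    ∑ x, star (ψ x) * ((if A x then ψ x - ψ (π x) else 0)
        + (if A (π x) then ψ x - ψ (π x) else 0))
      = ((∑ x, if A x then ‖ψ x - ψ (π x)‖ ^ 2 else 0 : ℝ) : ℂ) := by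
  have h : ∑ x, star (ψ x) * (if A (π x) then ψ x - ψ (π x) else 0)
      = ∑ x, star (ψ (π x)) * (if A x then ψ (π x) - ψ x else 0) := by
    refine Finset.sum_nbij' π π (by simp) (by simp) (fun x _ => hπ x) (fun x _ => hπ x) ?_
    intro x _
    rw [hπ]
  simp_rw [mul_add]
  rw [Finset.sum_add_distrib, h, ← Finset.sum_add_distrib]
  push_cast
  refine Finset.sum_congr rfl fun x _ => ?_
  split_ifs
  · rw [Complex.ofReal_pow, ← Complex.conj_mul', starRingEnd_apply, star_sub]
    ring
  · simp

variable {M : Matrix X X ℂ}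

theorem ext_of_mulVec [DecidableEq X] {A B : Matrix X X ℂ} (h : ∀ v, A *ᵥ v = B *ᵥ v) : A = B :=
  Matrix.ext_of_mulVec_single fun _ => h _

theorem form_eq_of_proj (hM : M.IsHermitian) (hMM : M * M = M) (v : X → ℂ) :
    star v ⬝ᵥ (M *ᵥ v) = ((∑ x, ‖(M *ᵥ v) x‖ ^ 2 : ℝ) : ℂ) := by
  rw [← star_dotProduct_self, star_mulVec, ← dotProduct_mulVec, mulVec_mulVec, hM.eq, hMM]

theorem sum_norm_sq_proj_le [DecidableEq X] (hM : M.IsHermitian) (hMM : M * M = M) (v : X → ℂ) :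
    ∑ x, ‖(M *ᵥ v) x‖ ^ 2 ≤ ∑ x, ‖v x‖ ^ 2 := by
  have h1 := form_eq_of_proj hM hMM v
  have h2 := form_eq_of_proj (M := 1 - M) (isHermitian_one.sub hM)
    (by simp [mul_sub, sub_mul, hMM]) v
  rw [sub_mulVec, one_mulVec, dotProduct_sub, h1, star_dotProduct_self] at h2
  norm_cast at h2
  have h3 : 0 ≤ ∑ x, ‖(v - M *ᵥ v) x‖ ^ 2 := by positivity
  linarith

end Generic

/-! ### Amplitudes of the two-site singlet. -/

section Singlet

theorem star_singlet (a b : Fin 3) : star (singlet a b) = singlet a b := by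
  unfold singlet
  split_ifs <;> simp

theorem singlet_two_left (b : Fin 3) : singlet 2 b = 0 := by simp [singlet]

theorem singlet_two_right (a : Fin 3) : singlet a 2 = 0 := by simp [singlet]

theorem singlet_swap (a b : Fin 3) : singlet b a = -singlet a b := by
  fin_cases a <;> fin_cases b <;> simp [singlet]

theorem inv_sqrt_two_sq : (Real.sqrt 2 : ℂ)⁻¹ * (Real.sqrt 2 : ℂ)⁻¹ = 1 / 2 := by
  rw [← mul_inv, ← Complex.ofReal_mul, Real.mul_self_sqrt (by norm_num)]
  norm_num

theorem sum_singlet_mul_singlet (a b : Fin 3) :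
    ∑ y, singlet a y * singlet b y = if a = b ∧ a ≠ 2 then 1 / 2 else 0 := by
  fin_cases a <;> fin_cases b <;>
    simp [singlet, inv_sqrt_two_sq]

theorem sum_singlet_sq : ∑ x, ∑ y, singlet x y * singlet x y = 1 := by
  simp_rw [sum_singlet_mul_singlet]
  simp [Fin.sum_univ_three]
  norm_num

end Singlet

/-! ### Action and quadratic form of the Hamiltonian. -/

section Hamiltonian

variable {N : ℕ}

section Swap

/-- Configuration with the contents of the sites `i`, `i + 1` exchanged. -/
def sw (i : ZMod N) (c : Conf N) : Conf N := c ∘ Equiv.swap i (i + 1)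

theorem sw_sw (i : ZMod N) (c : Conf N) : sw i (sw i c) = c := by
  funext j; simp [sw]

theorem sw_left (i : ZMod N) (c : Conf N) : sw i c i = c (i + 1) := by simp [sw]

theorem sw_right (i : ZMod N) (c : Conf N) : sw i c (i + 1) = c i := by simp [sw]

theorem eq_sw_iff (i : ZMod N) (c d : Conf N) : c = sw i d ↔ d = sw i c := by
  constructor <;> rintro rfl <;> rw [sw_sw]

end Swap

variable [NeZero N]

section Action

theorem swapAt_apply (i : ZMod N) (c d : Conf N) :
    swapAt N i c d = if d = sw i c then 1 else 0 := by
  simp only [swapAt, of_apply]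
  exact if_congr (eq_sw_iff i c d) rfl rfl

theorem holeAt_apply (i : ZMod N) (c d : Conf N) :
    holeAt N i c d = if d = c then (if c i = 2 then 1 else 0) else 0 := by
  rw [holeAt, diagonal_apply]
  exact if_congr eq_comm rfl rfl

theorem hop_apply (i : ZMod N) (c d : Conf N) :
    hop N i c d = if d = sw i c then (if c (i + 1) = 2 then 1 else 0) else 0 := by
  rw [hop, holeAt, mul_diagonal, swapAt_apply]
  split_ifs with h1 h2 h3 h3
  · simp
  · subst h1; rw [sw_left] at h2; exact absurd h2 h3
  · subst h1; rw [sw_left] at h2; exact absurd h3 h2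
  · simp
  · simp
  · simp

theorem hop_conjTranspose_apply (i : ZMod N) (c d : Conf N) :
    (hop N i)ᴴ c d = if d = sw i c then (if c i = 2 then 1 else 0) else 0 := by
  rw [conjTranspose_apply, hop_apply]
  by_cases h : d = sw i c
  · rw [if_pos ((eq_sw_iff _ _ _).2 h), if_pos h, h, sw_right]
    split_ifs <;> simp
  · rw [if_neg (fun h' => h ((eq_sw_iff _ _ _).2 h')), if_neg h, star_zero]

theorem mulVec_of_perm {A : RingOp N} {π : Conf N → Conf N} {w : Conf N → ℂ}
    (hA : ∀ c d, A c d = if d = π c then w c else 0) (φ : Conf N → ℂ) (c : Conf N) :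
    (A *ᵥ φ) c = w c * φ (π c) := by
  simp [mulVec, dotProduct, hA]

theorem mulVec_kronecker_of_perm {A B : RingOp N} {π ρ : Conf N → Conf N} {w u : Conf N → ℂ}
    (hA : ∀ c d, A c d = if d = π c then w c else 0)
    (hB : ∀ c d, B c d = if d = ρ c then u c else 0) (ψ : Conf N × Conf N → ℂ) (s : Conf N × Conf N) :
    ((A ⊗ₖ B) *ᵥ ψ) s = w s.1 * u s.2 * ψ (π s.1, ρ s.2) := by
  simp [mulVec, dotProduct, Fintype.sum_prod_type, kroneckerMap_apply, hA, hB]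

theorem mulVec_kronecker_one (A : RingOp N) (ψ : Conf N × Conf N → ℂ) (s : Conf N × Conf N) :
    ((A ⊗ₖ (1 : RingOp N)) *ᵥ ψ) s = (A *ᵥ fun c => ψ (c, s.2)) s.1 := by
  simp [mulVec, dotProduct, Fintype.sum_prod_type, kroneckerMap_apply, one_apply]

theorem mulVec_one_kronecker (A : RingOp N) (ψ : Conf N × Conf N → ℂ) (s : Conf N × Conf N) :
    (((1 : RingOp N) ⊗ₖ A) *ᵥ ψ) s = (A *ᵥ fun d => ψ (s.1, d)) s.2 := by
  simp [mulVec, dotProduct, Fintype.sum_prod_type, kroneckerMap_apply, one_apply]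

theorem ringHopping_mulVec (φ : Conf N → ℂ) (c : Conf N) :
    (ringHopping N *ᵥ φ) c = ∑ i ∈ Finset.univ.erase (0 : ZMod N),
      ((if c i = 2 then φ c - φ (sw i c) else 0)
        + (if sw i c i = 2 then φ c - φ (sw i c) else 0)) := by
  rw [ringHopping, sum_mulVec, Finset.sum_apply]
  refine Finset.sum_congr rfl fun i _ => ?_
  rw [sub_mulVec, sub_mulVec, add_mulVec, Pi.sub_apply, Pi.sub_apply, Pi.add_apply,
    mulVec_of_perm (holeAt_apply i), mulVec_of_perm (holeAt_apply (i + 1)),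
    mulVec_of_perm (hop_apply i), mulVec_of_perm (hop_conjTranspose_apply i), sw_left]
  split_ifs <;> ring

/-- Number of holes. -/
def holes (c : Conf N) : ℕ := (Finset.univ.filter fun i => c i = 2).card

/-- Number of bonds of the ring occupied by two holes. -/
def adjHoles (c : Conf N) : ℕ := (Finset.univ.filter fun i => c i = 2 ∧ c (i + 1) = 2).card

/-- Self-energy of the holes. -/
def selfEnergy (V₁ : ℝ) (c : Conf N) : ℝ := V₁ - V₁ * holes c + adjHoles c

theorem ringPotential_mulVec (V₁ : ℝ) (φ : Conf N → ℂ) (c : Conf N) :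
    (ringPotential N V₁ 1 *ᵥ φ) c = selfEnergy V₁ c * φ c := by
  have h2 : ∀ i : ZMod N, ((holeAt N i * holeAt N (i + 1)) *ᵥ φ) c
      = (if c i = 2 ∧ c (i + 1) = 2 then 1 else 0) * φ c := by
    intro i
    rw [← mulVec_mulVec, mulVec_of_perm (holeAt_apply i), mulVec_of_perm (holeAt_apply (i + 1))]
    by_cases h1 : c i = 2 <;> by_cases h2 : c (i + 1) = 2 <;> simp [h1, h2]
  rw [ringPotential, add_mulVec, sub_mulVec, smul_mulVec, smul_mulVec, smul_mulVec, one_mulVec,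
    sum_mulVec, sum_mulVec]
  simp only [Pi.add_apply, Pi.sub_apply, Pi.smul_apply, Finset.sum_apply,
    mulVec_of_perm (holeAt_apply _), h2, smul_eq_mul, ← Finset.sum_mul]
  rw [Finset.sum_boole, Finset.sum_boole, selfEnergy, holes, adjHoles]
  push_cast
  ring

theorem HB_mulVec (ψ : Conf N × Conf N → ℂ) (s : Conf N × Conf N) :
    (HB N *ᵥ ψ) s =
      (if s.1 0 = 2 ∧ s.2 0 = 2 then ψ s - ψ (sw 0 s.1, sw 0 s.2) else 0)
      + (if sw 0 s.1 0 = 2 ∧ sw 0 s.2 0 = 2 then ψ s - ψ (sw 0 s.1, sw 0 s.2) else 0) := by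
  have h := hop_apply (N := N) 0
  simp_rw [zero_add] at h
  rw [HB, sub_mulVec, sub_mulVec, add_mulVec, Pi.sub_apply, Pi.sub_apply, Pi.add_apply,
    mulVec_kronecker_of_perm (holeAt_apply 0) (holeAt_apply 0),
    mulVec_kronecker_of_perm (holeAt_apply 1) (holeAt_apply 1),
    mulVec_kronecker_of_perm h h,
    mulVec_kronecker_of_perm (hop_conjTranspose_apply 0) (hop_conjTranspose_apply 0), sw_left,
    sw_left, zero_add]
  by_cases h1 : s.1 0 = 2 <;> by_cases h2 : s.2 0 = 2 <;> by_cases h3 : s.1 1 = 2 <;>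
    by_cases h4 : s.2 1 = 2 <;> simp [h1, h2, h3, h4] <;> ring

end Action

section PairProj

/-- Projector onto the singlet of the two sites numbered `j`. -/
def pairProj (j : ZMod N) : PairOp N :=
  Matrix.of fun c d =>
    if ∀ i : ZMod N, i ≠ j → c.1 i = d.1 i ∧ c.2 i = d.2 i then
      singlet (c.1 j) (c.2 j) * star (singlet (d.1 j) (d.2 j))
    else 0

theorem singletProj_eq : singletProj N = pairProj 1 := rfl

theorem sum_agree (j : ZMod N) (c : Conf N) (F : Conf N → ℂ) :
    (∑ d, if ∀ i, i ≠ j → c i = d i then F d else 0) = ∑ x, F (Function.update c j x) := by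
  rw [← Finset.sum_filter]
  refine Finset.sum_bij' (fun d _ => d j) (fun x _ => Function.update c j x) ?_ ?_ ?_ ?_ ?_
  · simp
  · intro x _
    simp only [Finset.mem_filter, Finset.mem_univ, true_and]
    intro i hi
    simp [hi]
  · intro d hd
    simp only [Finset.mem_filter, Finset.mem_univ, true_and] at hd
    funext i
    by_cases hi : i = j
    · subst hi; simp
    · simp [hi, hd i hi]
  · intro x _; simp
  · intro d hd
    simp only [Finset.mem_filter, Finset.mem_univ, true_and] at hd
    congr 1
    funext i
    by_cases hi : i = j
    · subst hi; simp
    · simp [hi, hd i hi]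

theorem pairProj_mulVec (j : ZMod N) (ψ : Conf N × Conf N → ℂ) (s : Conf N × Conf N) :
    (pairProj j *ᵥ ψ) s = singlet (s.1 j) (s.2 j) * ∑ x, ∑ y, singlet x y *
      ψ (Function.update s.1 j x, Function.update s.2 j y) := by
  have h : (pairProj j *ᵥ ψ) s = ∑ c, if ∀ i, i ≠ j → s.1 i = c i then
      (∑ d, if ∀ i, i ≠ j → s.2 i = d i then
        singlet (s.1 j) (s.2 j) * singlet (c j) (d j) * ψ (c, d) else 0) else 0 := by
    rw [mulVec, dotProduct, Fintype.sum_prod_type]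
    refine Finset.sum_congr rfl fun c _ => ?_
    split_ifs with h1
    · refine Finset.sum_congr rfl fun d _ => ?_
      by_cases h2 : ∀ i, i ≠ j → s.2 i = d i
      · rw [if_pos h2, pairProj, of_apply, if_pos fun i hi => ⟨h1 i hi, h2 i hi⟩, star_singlet]
      · rw [if_neg h2, pairProj, of_apply, if_neg, zero_mul]
        exact fun h => h2 fun i hi => (h i hi).2
    · refine Finset.sum_eq_zero fun d _ => ?_
      rw [pairProj, of_apply, if_neg, zero_mul]
      exact fun h => h1 fun i hi => (h i hi).1
  rw [h, sum_agree, Finset.mul_sum]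
  refine Finset.sum_congr rfl fun x _ => ?_
  rw [sum_agree, Finset.mul_sum]
  refine Finset.sum_congr rfl fun y _ => ?_
  rw [Function.update_self, Function.update_self]
  ring

theorem pairProj_isHermitian (j : ZMod N) : (pairProj j).IsHermitian := by
  ext c d
  rw [conjTranspose_apply, pairProj, of_apply, of_apply]
  by_cases h : ∀ i : ZMod N, i ≠ j → c.1 i = d.1 i ∧ c.2 i = d.2 i
  · rw [if_pos h, if_pos fun i hi => ⟨(h i hi).1.symm, (h i hi).2.symm⟩]
    simp only [star_mul', star_singlet]
    ring
  · rw [if_neg h, if_neg, star_zero]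
    exact fun h' => h fun i hi => ⟨(h' i hi).1.symm, (h' i hi).2.symm⟩

theorem pairProj_mul_self (j : ZMod N) : pairProj j * pairProj j = pairProj j := by
  refine ext_of_mulVec fun ψ => ?_
  rw [← mulVec_mulVec]
  funext s
  rw [pairProj_mulVec]
  simp only [pairProj_mulVec, Function.update_self, Function.update_idem]
  have e : ∀ z : ℂ, ∑ x, ∑ y, singlet x y * (singlet x y * z) = z := by
    intro z
    simp_rw [← mul_assoc, ← Finset.sum_mul]
    rw [sum_singlet_sq, one_mul]
  congr 1
  exact e _

theorem pairProj_mul_comm {i j : ZMod N} (hij : i ≠ j) :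
    pairProj i * pairProj j = pairProj j * pairProj i := by
  refine ext_of_mulVec fun ψ => ?_
  rw [← mulVec_mulVec, ← mulVec_mulVec]
  funext s
  simp only [pairProj_mulVec, Function.update_of_ne hij, Function.update_of_ne hij.symm,
    Finset.mul_sum]
  have e : ∀ F : Fin 3 → Fin 3 → Fin 3 → Fin 3 → ℂ, ∑ x, ∑ y, ∑ x', ∑ y', F x y x' y'
      = ∑ x', ∑ y', ∑ x, ∑ y, F x y x' y' := by
    intro F
    have := Finset.sum_comm (s := (Finset.univ : Finset (Fin 3 × Fin 3)))
      (t := (Finset.univ : Finset (Fin 3 × Fin 3))) (f := fun p q => F p.1 p.2 q.1 q.2)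
    simpa only [Fintype.sum_prod_type] using this
  refine (e _).trans ?_
  refine Finset.sum_congr rfl fun x' _ => Finset.sum_congr rfl fun y' _ =>
    Finset.sum_congr rfl fun x _ => Finset.sum_congr rfl fun y _ => ?_
  rw [Function.update_comm hij.symm, Function.update_comm hij.symm]
  ring

theorem HP_mulVec (ψ : Conf N × Conf N → ℂ) (s : Conf N × Conf N) :
    (HP N *ᵥ ψ) s = (if s.1 1 ≠ 2 ∧ s.2 1 ≠ 2 then ψ s else 0) - (pairProj 1 *ᵥ ψ) s := by
  have h : ∀ c d : Conf N, (1 - holeAt N 1) c d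
      = if d = id c then (if c 1 ≠ 2 then 1 else 0) else 0 := by
    intro c d
    rw [Matrix.sub_apply, holeAt_apply, one_apply]
    by_cases h1 : d = c
    · subst h1; by_cases h2 : d 1 = 2 <;> simp [h2]
    · simp [h1, Ne.symm h1]
  rw [HP, sub_mulVec, Pi.sub_apply, mulVec_kronecker_of_perm h h, singletProj_eq]
  by_cases h1 : s.1 1 = 2 <;> by_cases h2 : s.2 1 = 2 <;> simp [h1, h2]

theorem holeAt_isHermitian (i : ZMod N) : (holeAt N i).IsHermitian := by
  rw [holeAt, IsHermitian, diagonal_conjTranspose]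
  congr 1
  funext c
  rw [Pi.star_apply]
  split_ifs <;> simp

theorem HP_isHermitian : (HP N).IsHermitian := by
  have h : (1 - holeAt N 1).IsHermitian := isHermitian_one.sub (holeAt_isHermitian 1)
  exact (kronecker_isHermitian h h).sub (pairProj_isHermitian 1)

/-- The singlet lies in the range of the projector onto no hole at the two sites 1, so `HP` is a
difference of nested projectors. -/
theorem HP_mul_self : HP N * HP N = HP N := by
  refine ext_of_mulVec fun ψ => ?_
  rw [← mulVec_mulVec]
  have h1 : ∀ φ : Conf N × Conf N → ℂ, (pairProj (1 : ZMod N) *ᵥ (HP N *ᵥ φ)) = 0 := by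
    intro φ
    have e : HP N *ᵥ φ = (fun s => if s.1 1 ≠ 2 ∧ s.2 1 ≠ 2 then φ s else 0)
        - pairProj 1 *ᵥ φ := by
      funext s; rw [HP_mulVec]; rfl
    rw [e, mulVec_sub, mulVec_mulVec, pairProj_mul_self, sub_eq_zero]
    funext s
    rw [pairProj_mulVec, pairProj_mulVec]
    congr 1
    refine Finset.sum_congr rfl fun x _ => Finset.sum_congr rfl fun y _ => ?_
    simp only [Function.update_self]
    by_cases hx : x = 2
    · subst hx; rw [singlet_two_left]; simp
    by_cases hy : y = 2
    · subst hy; rw [singlet_two_right]; simp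
    rw [if_pos ⟨hx, hy⟩]
  funext s
  rw [HP_mulVec, h1, Pi.zero_apply, sub_zero]
  split_ifs with h
  · rfl
  · rw [HP_mulVec, if_neg h, zero_sub, pairProj_mulVec]
    rw [not_and_or, not_ne_iff, not_ne_iff] at h
    rcases h with h | h <;> simp [h, singlet_two_left, singlet_two_right]

end PairProj

section Form

theorem ringHopping_isHermitian : (ringHopping N).IsHermitian := by
  rw [ringHopping]
  refine isSelfAdjoint_sum _ fun i _ => ?_
  change IsHermitian _
  rw [IsHermitian]
  simp only [conjTranspose_sub, conjTranspose_add, conjTranspose_conjTranspose,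
    (holeAt_isHermitian _).eq]
  abel

theorem ringPotential_isHermitian (V₁ : ℝ) : (ringPotential N V₁ 1).IsHermitian := by
  have h : ringPotential N V₁ 1 = diagonal fun c => (selfEnergy V₁ c : ℂ) := by
    refine ext_of_mulVec fun φ => ?_
    funext c
    rw [ringPotential_mulVec, mulVec_diagonal]
  rw [h, IsHermitian, diagonal_conjTranspose]
  congr 1
  funext c
  simp

theorem hamiltonian_isHermitian (V₁ : ℝ) : (hamiltonian N V₁ 1).IsHermitian := by
  refine ((((kronecker_isHermitian ringHopping_isHermitian isHermitian_one).add
    (kronecker_isHermitian isHermitian_one ringHopping_isHermitian)).add ?_).add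
    HP_isHermitian).add
    ((kronecker_isHermitian (ringPotential_isHermitian V₁) isHermitian_one).add
    (kronecker_isHermitian isHermitian_one (ringPotential_isHermitian V₁)))
  rw [HB, IsHermitian]
  simp only [conjTranspose_sub, conjTranspose_add, conjTranspose_kronecker,
    conjTranspose_conjTranspose, (holeAt_isHermitian _).eq]
  abel

/-- Energy of a function on one ring. -/
def ringEnergy (V₁ : ℝ) (φ : Conf N → ℂ) (c : Conf N) : ℝ :=
  ∑ i ∈ Finset.univ.erase (0 : ZMod N), (if c i = 2 then ‖φ c - φ (sw i c)‖ ^ 2 else 0)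
    + selfEnergy V₁ c * ‖φ c‖ ^ 2

/-- Energy of the coupling of the two rings. -/
def couplingEnergy (ψ : Conf N × Conf N → ℂ) (s : Conf N × Conf N) : ℝ :=
  (if s.1 0 = 2 ∧ s.2 0 = 2 then ‖ψ s - ψ (sw 0 s.1, sw 0 s.2)‖ ^ 2 else 0)
    + ‖(HP N *ᵥ ψ) s‖ ^ 2

/-- Local energy density. -/
def density (V₁ : ℝ) (ψ : Conf N × Conf N → ℂ) (s : Conf N × Conf N) : ℝ :=
  ringEnergy V₁ (fun c => ψ (c, s.2)) s.1 + ringEnergy V₁ (fun d => ψ (s.1, d)) s.2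
    + couplingEnergy ψ s

theorem ring_form (V₁ : ℝ) (φ : Conf N → ℂ) :
    ∑ c, star (φ c) * ((ringHopping N *ᵥ φ) c + (ringPotential N V₁ 1 *ᵥ φ) c)
      = ((∑ c, ringEnergy V₁ φ c : ℝ) : ℂ) := by
  unfold ringEnergy
  simp_rw [mul_add, Finset.sum_add_distrib]
  push_cast
  congr 1
  · simp_rw [ringHopping_mulVec, Finset.mul_sum]
    rw [Finset.sum_comm, Finset.sum_comm (s := Finset.univ)]
    refine Finset.sum_congr rfl fun i _ => ?_
    have := edge_form (sw i) (sw_sw i) (fun c : Conf N => c i = 2) φ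
    rw [this]
    push_cast
    rfl
  · refine Finset.sum_congr rfl fun c _ => ?_
    rw [ringPotential_mulVec, ← Complex.conj_mul', starRingEnd_apply]
    ring

theorem hamiltonian_mulVec (V₁ : ℝ) (ψ : Conf N × Conf N → ℂ) (s : Conf N × Conf N) :
    (hamiltonian N V₁ 1 *ᵥ ψ) s =
      ((ringHopping N *ᵥ fun c => ψ (c, s.2)) s.1 + (ringPotential N V₁ 1 *ᵥ fun c => ψ (c, s.2)) s.1)
      + ((ringHopping N *ᵥ fun d => ψ (s.1, d)) s.2 + (ringPotential N V₁ 1 *ᵥ fun d => ψ (s.1, d)) s.2)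
      + ((HB N *ᵥ ψ) s + (HP N *ᵥ ψ) s) := by
  simp only [hamiltonian, HL, HR, HV, add_mulVec, Pi.add_apply, mulVec_kronecker_one,
    mulVec_one_kronecker]
  ring

/-- Exchanging two sites is an involution of the configurations, so each hopping term is the
Laplacian of a matching (`edge_form`), while `HP` is a projector. Both give squares; only the
self-energy can be negative. -/
theorem form_eq (V₁ : ℝ) (ψ : Conf N × Conf N → ℂ) :
    star ψ ⬝ᵥ (hamiltonian N V₁ 1 *ᵥ ψ) = ((∑ s, density V₁ ψ s : ℝ) : ℂ) := by
  have hL : ∑ s : Conf N × Conf N, star (ψ s) * ((ringHopping N *ᵥ fun c => ψ (c, s.2)) s.1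
      + (ringPotential N V₁ 1 *ᵥ fun c => ψ (c, s.2)) s.1)
      = ((∑ s : Conf N × Conf N, ringEnergy V₁ (fun c => ψ (c, s.2)) s.1 : ℝ) : ℂ) := by
    rw [Fintype.sum_prod_type_right, Fintype.sum_prod_type_right]
    push_cast
    refine Finset.sum_congr rfl fun d _ => ?_
    rw [ring_form V₁ fun c => ψ (c, d)]
    push_cast
    rfl
  have hR : ∑ s : Conf N × Conf N, star (ψ s) * ((ringHopping N *ᵥ fun d => ψ (s.1, d)) s.2
      + (ringPotential N V₁ 1 *ᵥ fun d => ψ (s.1, d)) s.2)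
      = ((∑ s : Conf N × Conf N, ringEnergy V₁ (fun d => ψ (s.1, d)) s.2 : ℝ) : ℂ) := by
    rw [Fintype.sum_prod_type, Fintype.sum_prod_type]
    push_cast
    refine Finset.sum_congr rfl fun c _ => ?_
    rw [ring_form V₁ fun d => ψ (c, d)]
    push_cast
    rfl
  have hB : ∑ s : Conf N × Conf N, star (ψ s) * (HB N *ᵥ ψ) s
      = ((∑ s : Conf N × Conf N, if s.1 0 = 2 ∧ s.2 0 = 2 then
          ‖ψ s - ψ (sw 0 s.1, sw 0 s.2)‖ ^ 2 else 0 : ℝ) : ℂ) := by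
    rw [← edge_form (fun s : Conf N × Conf N => (sw 0 s.1, sw 0 s.2))
      (fun s => by simp [sw_sw]) (fun s => s.1 0 = 2 ∧ s.2 0 = 2) ψ]
    refine Finset.sum_congr rfl fun s _ => ?_
    rw [HB_mulVec]
  have hP := form_eq_of_proj (HP_isHermitian (N := N)) HP_mul_self ψ
  rw [dotProduct] at hP
  simp only [Pi.star_apply] at hP
  rw [dotProduct]
  simp_rw [Pi.star_apply, hamiltonian_mulVec, mul_add _ (_ + _ + _), mul_add _ (_ + _) (_ + _),
    mul_add _ ((HB N *ᵥ ψ) _), Finset.sum_add_distrib]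
  rw [hL, hR, hB, hP]
  unfold density couplingEnergy
  simp_rw [Finset.sum_add_distrib]
  push_cast
  ring

end Form

end Hamiltonian

/-! ### Linear order of the sites along the open chain of hopping bonds. -/

section Sites

variable {N : ℕ}

/-- The sites of the ring in the order `1, …, N`, counted from `0`. -/
def site (N k : ℕ) : ZMod N := (k : ZMod N) + 1

theorem site_zero : site N 0 = 1 := by simp [site]

theorem site_succ (k : ℕ) : site N (k + 1) = site N k + 1 := by simp [site]

/-- Position of a site in the order `1, …, N`, counted from `0`. -/
def pos (j : ZMod N) : ℕ := (j - 1).val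

theorem pos_site {k : ℕ} (hk : k < N) : pos (site N k) = k := by
  rw [pos, site, add_sub_cancel_right, ZMod.val_natCast_of_lt hk]

theorem site_inj {k l : ℕ} (hk : k < N) (hl : l < N) : site N k = site N l ↔ k = l :=
  ⟨fun h => by rw [← pos_site hk, h, pos_site hl], fun h => by rw [h]⟩

variable [NeZero N]

theorem site_last : site N (N - 1) = 0 := by
  have h : N - 1 + 1 = N := Nat.sub_add_cancel NeZero.one_le
  have := congrArg (Nat.cast : ℕ → ZMod N) h
  push_cast at this
  rw [site, this, ZMod.natCast_self]

theorem pos_lt (j : ZMod N) : pos j < N := ZMod.val_lt _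

theorem site_pos (j : ZMod N) : site N (pos j) = j := by
  rw [pos, site, ZMod.natCast_zmod_val, sub_add_cancel]

theorem pos_injective : Function.Injective (pos : ZMod N → ℕ) := fun i j h => by
  rw [← site_pos i, h, site_pos]

theorem pos_succ_lt {i : ZMod N} (hi : i ≠ 0) : pos i + 1 < N := by
  rcases Nat.lt_or_ge (pos i + 1) N with h | h
  · exact h
  · exfalso
    apply hi
    have := pos_lt i
    rw [← site_pos i, show pos i = N - 1 by omega, site_last]

theorem pos_add_one {i : ZMod N} (hi : i ≠ 0) : pos (i + 1) = pos i + 1 := by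
  conv_lhs => rw [← site_pos i, ← site_succ]
  exact pos_site (pos_succ_lt hi)

theorem sum_erase_zero {β : Type*} [AddCommMonoid β] (F : ZMod N → β) :
    ∑ i ∈ Finset.univ.erase (0 : ZMod N), F i = ∑ k ∈ Finset.range (N - 1), F (site N k) := by
  refine Finset.sum_bij' (fun i _ => pos i) (fun k _ => site N k) ?_ ?_ ?_ ?_ ?_
  · intro i hi
    have := pos_succ_lt (Finset.ne_of_mem_erase hi)
    rw [Finset.mem_range]
    omega
  · intro k hk
    rw [Finset.mem_range] at hk
    rw [Finset.mem_erase, ← site_last, Ne, site_inj (by omega) (by omega)]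
    exact ⟨by omega, Finset.mem_univ _⟩
  · intro i _; exact site_pos i
  · intro k hk
    rw [Finset.mem_range] at hk
    exact pos_site (by omega)
  · intro i _; rw [site_pos]

end Sites

/-! ### Energy cost of a ring whose number of holes is not one. -/

section RingBound

variable {N : ℕ} [NeZero N]

theorem holes_sw (i : ZMod N) (c : Conf N) : holes (sw i c) = holes c := by
  unfold holes
  refine Finset.card_bij' (fun j _ => Equiv.swap i (i + 1) j) (fun j _ => Equiv.swap i (i + 1) j)
    (fun j hj => ?_) (fun j hj => ?_) (by simp) (by simp)
  · exact Finset.mem_filter.2 ⟨Finset.mem_univ _, (Finset.mem_filter.1 hj).2⟩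
  · refine Finset.mem_filter.2 ⟨Finset.mem_univ _, ?_⟩
    rw [sw, Function.comp_apply, Equiv.swap_apply_self]
    exact (Finset.mem_filter.1 hj).2

/-- Position of the first hole. -/
def firstHole (c : Conf N) : ℕ := sInf (pos '' {j | c j = 2})

theorem le_firstHole {c : Conf N} {x : ℕ} (h0 : holes c ≠ 0) (h : ∀ j, c j = 2 → x ≤ pos j) :
    x ≤ firstHole c := by
  obtain ⟨j, hj⟩ := Finset.card_ne_zero.1 h0
  refine le_csInf ⟨pos j, j, by simpa using hj, rfl⟩ ?_
  rintro _ ⟨j, hj, rfl⟩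
  exact h j hj

theorem exists_firstHole {c : Conf N} (h0 : holes c ≠ 0) :
    ∃ j, c j = 2 ∧ pos j = firstHole c ∧ ∀ j', c j' = 2 → pos j ≤ pos j' := by
  obtain ⟨j, hj⟩ := Finset.card_ne_zero.1 h0
  have hne : (pos '' {j | c j = 2}).Nonempty := ⟨pos j, j, by simpa using hj, rfl⟩
  obtain ⟨i, hi, hi'⟩ := Nat.sInf_mem hne
  exact ⟨i, hi, hi', fun j' hj' => hi' ▸ Nat.sInf_le ⟨j', hj', rfl⟩⟩

/-- A positive function on which the Hamiltonian of a ring with two or more holes acts as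
multiplication by at least a positive constant. -/
def weight (c : Conf N) : ℝ := if 2 ≤ holes c then 2 * (N : ℝ) ^ 2 - (firstHole c : ℝ) ^ 2 else 1

theorem weight_pos (c : Conf N) : 0 < weight c := by
  unfold weight
  split_ifs with h
  · obtain ⟨j, -, hj, -⟩ := exists_firstHole (c := c) (by omega)
    have h1 : (firstHole c : ℝ) ≤ N := by rw [← hj]; exact_mod_cast (pos_lt j).le
    have h2 : (0 : ℝ) < N := by exact_mod_cast NeZero.pos N
    nlinarith [(Nat.cast_nonneg (firstHole c) : (0 : ℝ) ≤ _)]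
  · norm_num

/-- Ground state substitution on one edge: after replacing |x - y| by the difference of moduli, what
remains is a perfect square over h h'. -/
theorem edge_ge {x y : ℂ} {h h' : ℝ} (hh : 0 < h) (hh' : 0 < h') :
    (1 - h' / h) * ‖x‖ ^ 2 + (1 - h / h') * ‖y‖ ^ 2 ≤ ‖x - y‖ ^ 2 := by
  have h1 : (‖x‖ - ‖y‖) ^ 2 ≤ ‖x - y‖ ^ 2 :=
    sq_le_sq' (by have := norm_sub_norm_le y x; rw [norm_sub_rev] at this; linarith)
      (norm_sub_norm_le x y)
  refine le_trans ?_ h1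
  have h2 : (‖x‖ - ‖y‖) ^ 2 - ((1 - h' / h) * ‖x‖ ^ 2 + (1 - h / h') * ‖y‖ ^ 2)
      = (h' * ‖x‖ - h * ‖y‖) ^ 2 / (h * h') := by
    field_simp
    ring
  have : 0 ≤ (h' * ‖x‖ - h * ‖y‖) ^ 2 / (h * h') := by positivity
  linarith

/-- Hardy inequality: the hopping energy dominates the potential (Laplacian of `weight`)/`weight`,
so a pointwise lower bound on that potential suffices. -/
theorem sum_edges_ge (i : ZMod N) (φ : Conf N → ℂ) :
    ∑ c, ((if c i = 2 then 1 - weight (sw i c) / weight c else 0)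
        + (if sw i c i = 2 then 1 - weight (sw i c) / weight c else 0)) * ‖φ c‖ ^ 2
      ≤ ∑ c, if c i = 2 then ‖φ c - φ (sw i c)‖ ^ 2 else 0 := by
  have h : ∑ c, (if sw i c i = 2 then 1 - weight (sw i c) / weight c else 0) * ‖φ c‖ ^ 2
      = ∑ c, (if c i = 2 then 1 - weight c / weight (sw i c) else 0) * ‖φ (sw i c)‖ ^ 2 := by
    refine Finset.sum_nbij' (sw i) (sw i) (by simp) (by simp) (fun c _ => sw_sw i c)
      (fun c _ => sw_sw i c) ?_
    intro c _
    rw [sw_sw]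
  simp_rw [add_mul]
  rw [Finset.sum_add_distrib, h, ← Finset.sum_add_distrib]
  refine Finset.sum_le_sum fun c _ => ?_
  split_ifs
  · exact edge_ge (weight_pos _) (weight_pos _)
  · simp

/-- Let m be the position of the first hole and h the weight 2N² - m². Moving that hole forward
lowers the weight by at least 2m + 1; moving it back raises it by 2m - 1; other moves never bring a
hole before m, so they do not raise it. The net gain is at least 1/h, and h ≤ 2N² ≤ N³. If the next
site is also a hole the forward move is void, but the repulsion of neighbours then pays 1. -/
theorem sum_weight_ge (hN : 2 ≤ N) {c : Conf N} (h2 : 2 ≤ holes c) :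
    1 / (N : ℝ) ^ 3 ≤ ∑ i ∈ Finset.univ.erase (0 : ZMod N),
      ((if c i = 2 then 1 - weight (sw i c) / weight c else 0)
        + (if sw i c i = 2 then 1 - weight (sw i c) / weight c else 0)) + adjHoles c := by
  obtain ⟨j, hj, hjf, hmin⟩ := exists_firstHole (c := c) (by omega)
  obtain ⟨j', hj', hne⟩ : ∃ j', c j' = 2 ∧ j' ≠ j := by
    by_contra! hcon
    have : holes c ≤ 1 := by
      unfold holes
      rw [Finset.card_le_one]
      intro a ha b hb
      rw [hcon a (by simpa using ha), hcon b (by simpa using hb)]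
    omega
  have hlt : pos j < pos j' := lt_of_le_of_ne (hmin j' hj') fun h => hne (pos_injective h).symm
  -- Site 0 is the last one; as a second hole lies further on, the bond following the first hole
  -- belongs to the open chain.
  have hj0 : j ≠ 0 := by
    rintro rfl
    have h1 := pos_lt j'
    have h2 := pos_site (N := N) (k := N - 1) (by omega)
    rw [site_last] at h2
    omega
  set m := firstHole c with hm
  have hmN : m + 2 ≤ N := by have := pos_lt j'; omega
  have hmN' : (m : ℝ) + 2 ≤ N := by exact_mod_cast hmN
  have hm0 : (0 : ℝ) ≤ m := by positivity
  have hN2 : (2 : ℝ) ≤ N := by exact_mod_cast hN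
  have hw : weight c = 2 * (N : ℝ) ^ 2 - (m : ℝ) ^ 2 := by rw [weight, if_pos h2]
  have hpos := weight_pos c
  set h := weight c
  have hle : ∀ i : ZMod N, ∀ x : ℕ, (∀ a, sw i c a = 2 → x ≤ pos a) →
      ((m : ℝ) ^ 2 - x ^ 2) / h * (-1) ≤ 1 - weight (sw i c) / h := by
    intro i x hx
    have h1 : x ≤ firstHole (sw i c) := le_firstHole (by rw [holes_sw]; omega) hx
    have h2' : (x : ℝ) ≤ firstHole (sw i c) := by exact_mod_cast h1
    have h3 : weight (sw i c) ≤ 2 * (N : ℝ) ^ 2 - (x : ℝ) ^ 2 := by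
      rw [weight, if_pos (by rw [holes_sw]; exact h2)]
      have : (x : ℝ) ^ 2 ≤ (firstHole (sw i c) : ℝ) ^ 2 := by gcongr
      linarith
    rw [one_sub_div hpos.ne', div_mul_eq_mul_div]
    gcongr
    linarith
  set a : ℝ := if c (j + 1) = 2 then 0 else (2 * m + 1) / h with ha
  -- Bond by bond: gain a on the bond after the first hole, loss at most 2m/h on the bond before it,
  -- no loss elsewhere. When m = 0 the bond before it is absent and the bound 2m/h is zero.
  have hterm : ∀ i ∈ Finset.univ.erase (0 : ZMod N),
      (if i = j then a else 0) + (if i = j - 1 then -(2 * m / h) else 0)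
      ≤ ((if c i = 2 then 1 - weight (sw i c) / h else 0)
        + (if sw i c i = 2 then 1 - weight (sw i c) / h else 0)) := by
    intro i hi
    have hi0 : i ≠ 0 := Finset.ne_of_mem_erase hi
    have hp := pos_add_one hi0
    have hswa : ∀ b, sw i c b = 2 → b ≠ i → b ≠ i + 1 → m ≤ pos b := by
      intro b hb h1 h2
      rw [sw, Function.comp_apply, Equiv.swap_apply_of_ne_of_ne h1 h2] at hb
      rw [← hjf]
      exact hmin b hb
    by_cases hij : i = j
    · subst hij
      have hii : i ≠ i - 1 := by
        intro h
        have : (i - 1) + 1 = i := by ring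
        rw [← h] at this
        rw [this] at hp
        omega
      rw [if_pos rfl, if_neg hii, add_zero, if_pos hj, sw_left, ha]
      by_cases hc : c (i + 1) = 2
      · have : sw i c = c := by
          funext b
          rw [sw, Function.comp_apply]
          by_cases h1 : b = i
          · subst h1; rw [Equiv.swap_apply_left, hc, hj]
          by_cases h2 : b = i + 1
          · subst h2; rw [Equiv.swap_apply_right, hc, hj]
          rw [Equiv.swap_apply_of_ne_of_ne h1 h2]
        rw [if_pos hc, if_pos hc, this, div_self hpos.ne']
        simp
      · rw [if_neg hc, if_neg hc, add_zero]
        refine le_trans (le_of_eq ?_) (hle i (m + 1) ?_)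
        · push_cast; ring
        · intro b hb
          by_cases h1 : b = i
          · subst h1; rw [sw_left] at hb; exact absurd hb hc
          by_cases h2 : b = i + 1
          · subst h2; omega
          have h3 := hswa b hb h1 h2
          have h4 : pos b ≠ pos i := fun h => h1 (pos_injective h)
          omega
    · rw [if_neg hij, zero_add]
      by_cases hi1 : i = j - 1
      · have hi1' : i + 1 = j := by rw [hi1]; ring
        have hci : c i ≠ 2 := by
          intro h
          have := hmin i h
          rw [← hi1', hp] at this
          omega
        rw [if_pos hi1, if_neg hci, sw_left, if_pos (by rw [hi1']; exact hj), zero_add]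
        have hm1 : pos i + 1 = m := by rw [← hjf, ← hi1', hp]
        refine le_trans ?_ (hle i (pos i) ?_)
        · have : (pos i : ℝ) = m - 1 := by rw [← hm1]; push_cast; ring
          rw [this, div_mul_eq_mul_div, ← neg_div]
          gcongr
          nlinarith
        · intro b hb
          by_cases h1 : b = i
          · subst h1; rfl
          by_cases h2 : b = i + 1
          · subst h2; omega
          have := hswa b hb h1 h2
          omega
      · rw [if_neg hi1]
        have key : c i = 2 ∨ sw i c i = 2 → 0 ≤ 1 - weight (sw i c) / h := by
          intro hor
          refine le_trans (le_of_eq ?_) (hle i m ?_)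
          · simp
          · have hpi : m ≤ pos i := by
              rcases hor with h | h
              · rw [← hjf]; exact hmin i h
              · rw [sw_left] at h
                have h1 := hmin _ h
                have h2 : pos j ≠ pos (i + 1) := by
                  intro h
                  apply hi1
                  rw [pos_injective h]
                  ring
                omega
            intro b hb
            by_cases h1 : b = i
            · subst h1; exact hpi
            by_cases h2 : b = i + 1
            · subst h2; omega
            exact hswa b hb h1 h2
        refine add_nonneg ?_ ?_
        · split_ifs with h
          · exact key (Or.inl h)
          · rfl
        · split_ifs with h
          · exact key (Or.inr h)
          · rfl
  have hsum := Finset.sum_le_sum hterm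
  rw [Finset.sum_add_distrib, Finset.sum_ite_eq', if_pos (by simp [hj0]), Finset.sum_ite_eq'] at hsum
  have hb : -(2 * m / h) ≤ if j - 1 ∈ Finset.univ.erase (0 : ZMod N) then -(2 * m / h) else 0 := by
    split_ifs
    · rfl
    · have : 0 ≤ 2 * m / h := by positivity
      linarith
  have hfin : 1 / (N : ℝ) ^ 3 ≤ a - 2 * m / h + adjHoles c := by
    have hN3 : (0 : ℝ) < (N : ℝ) ^ 3 := by positivity
    by_cases hc : c (j + 1) = 2
    · have hadj : (1 : ℝ) ≤ adjHoles c := by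
        have : 0 < adjHoles c := Finset.card_pos.2 ⟨j, by simp [hj, hc]⟩
        exact_mod_cast this
      have h1 : 2 * m / h ≤ 1 - 1 / (N : ℝ) ^ 3 := by
        rw [div_le_iff₀ hpos, sub_mul, one_mul, div_mul_eq_mul_div, one_mul]
        have hh : h ≤ 2 * (N : ℝ) ^ 2 := by rw [hw]; nlinarith
        have h5 : h / (N : ℝ) ^ 3 ≤ 1 := by
          rw [div_le_one hN3]
          nlinarith
        nlinarith
      rw [ha, if_pos hc]
      linarith
    · rw [ha, if_neg hc]
      have h1 : 1 / (N : ℝ) ^ 3 ≤ 1 / h := by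
        apply one_div_le_one_div_of_le hpos
        rw [hw]
        nlinarith [sq_nonneg (N : ℝ), mul_nonneg (sub_nonneg.2 hN2) (sq_nonneg (N : ℝ))]
      have h2 : (2 * (m : ℝ) + 1) / h - 2 * m / h = 1 / h := by ring
      have h3 : (0 : ℝ) ≤ adjHoles c := by positivity
      linarith
  linarith

/-- The value V₁ = 1/N⁴ is tuned here: for two or more holes the gain 1/N³ covers V₁ times the
number of holes, which is at most N, and leaves V₁. With fewer holes the weight is constant and only
the self-energy counts: V₁ for none, 0 for one. -/
theorem sum_ringEnergy_ge (hN : 2 ≤ N) (φ : Conf N → ℂ) :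
    1 / (N : ℝ) ^ 4 * ∑ c, (if holes c = 1 then 0 else ‖φ c‖ ^ 2)
      ≤ ∑ c, ringEnergy (1 / (N : ℝ) ^ 4) φ c := by
  unfold ringEnergy
  rw [Finset.sum_add_distrib, Finset.sum_comm]
  have h1 := Finset.sum_le_sum fun (i : ZMod N) (_ : i ∈ Finset.univ.erase (0 : ZMod N)) =>
    sum_edges_ge i φ
  rw [Finset.sum_comm] at h1
  refine le_trans ?_ (add_le_add_left h1 _)
  rw [← Finset.sum_add_distrib, Finset.mul_sum]
  refine Finset.sum_le_sum fun c _ => ?_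
  rw [← Finset.sum_mul, ← add_mul]
  have hadj : (0 : ℝ) ≤ adjHoles c := by positivity
  have hV : (0 : ℝ) ≤ 1 / (N : ℝ) ^ 4 := by positivity
  have hN0 : (N : ℝ) ≠ 0 := by exact_mod_cast NeZero.ne N
  by_cases h2 : 2 ≤ holes c
  · rw [if_neg (by omega)]
    refine mul_le_mul_of_nonneg_right ?_ (by positivity)
    have h3 := sum_weight_ge hN h2
    have h4 : (holes c : ℝ) ≤ N := by
      have : holes c ≤ N := by
        refine (Finset.card_le_univ _).trans (le_of_eq (ZMod.card N))
      exact_mod_cast this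
    have h5 : 1 / (N : ℝ) ^ 4 * holes c ≤ 1 / (N : ℝ) ^ 3 := by
      calc 1 / (N : ℝ) ^ 4 * holes c ≤ 1 / (N : ℝ) ^ 4 * N := by gcongr
        _ = _ := by field_simp
    unfold selfEnergy
    linarith
  · have hz : ∑ i ∈ Finset.univ.erase (0 : ZMod N),
        ((if c i = 2 then 1 - weight (sw i c) / weight c else 0)
        + (if sw i c i = 2 then 1 - weight (sw i c) / weight c else 0)) = 0 := by
      refine Finset.sum_eq_zero fun i _ => ?_
      have : weight (sw i c) / weight c = 1 := by
        rw [weight, weight, holes_sw, if_neg h2, if_neg h2, div_one]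
      rw [this]
      simp
    rw [hz, zero_add, selfEnergy]
    rcases (by omega : holes c = 0 ∨ holes c = 1) with h | h
    · rw [h, if_neg (by omega)]
      refine mul_le_mul_of_nonneg_right ?_ (by positivity)
      push_cast
      linarith
    · rw [h, if_pos rfl, mul_zero]
      push_cast
      have : 0 ≤ 1 / (N : ℝ) ^ 4 - 1 / (N : ℝ) ^ 4 * 1 + adjHoles c := by linarith
      positivity

end RingBound

/-! ### Transport of the holes and resummation over their positions. -/

section Transport

/-- Permutation of the sites that transports a hole from the site `1` to the `k`-th next one. -/
def carry (N : ℕ) : ℕ → Equiv.Perm (ZMod N)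
  | 0 => 1
  | k + 1 => carry N k * Equiv.swap (site N k) (site N k + 1)

/-- Cyclic permutation of the sites `2, …, N` made by a hole going once around the ring. -/
def turn (N : ℕ) : Equiv.Perm (ZMod N) := carry N (N - 1) * Equiv.swap 0 (0 + 1)

variable {N : ℕ}

theorem comp_carry_succ (c : Conf N) (k : ℕ) :
    c ∘ carry N (k + 1) = sw (site N k) (c ∘ carry N k) := rfl

theorem carry_site {k : ℕ} (hk : k < N) {t : ℕ} (ht : t < N) :
    carry N k (site N t) = if t < k then site N (t + 1) else if t = k then 1 else site N t := by
  induction k generalizing t with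
  | zero =>
    rcases Nat.eq_zero_or_pos t with rfl | h
    · simp [carry, site_zero]
    · simp [carry, h.ne']
  | succ k ih =>
    have ih := fun t ht => ih (by omega) (t := t) ht
    rw [carry, Equiv.Perm.mul_apply, ← site_succ]
    rcases lt_trichotomy t k with h | h | h
    · rw [Equiv.swap_apply_of_ne_of_ne, ih t ht, if_pos h, if_pos (by omega)]
      · rw [Ne, site_inj ht (by omega)]; omega
      · rw [Ne, site_inj ht hk]; omega
    · subst h
      rw [Equiv.swap_apply_left, ih _ hk, if_neg (by omega), if_neg (by omega), if_pos (by omega)]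
    · by_cases h' : t = k + 1
      · subst h'
        rw [Equiv.swap_apply_right, ih _ (by omega), if_neg (by omega), if_pos rfl,
          if_neg (by omega), if_pos rfl]
      · rw [Equiv.swap_apply_of_ne_of_ne, ih t ht, if_neg (by omega), if_neg (by omega),
          if_neg (by omega), if_neg (by omega)]
        · rw [Ne, site_inj ht (by omega)]; omega
        · rw [Ne, site_inj ht hk]; omega

theorem carry_site_self {k : ℕ} (hk : k < N) : carry N k (site N k) = 1 := by
  rw [carry_site hk hk, if_neg (lt_irrefl _), if_pos rfl]

theorem carry_one {k : ℕ} (hk : k < N) (h0 : 0 < k) : carry N k 1 = site N 1 := by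
  rw [← site_zero, carry_site hk (by omega), if_pos h0]

theorem carry_symm_one {k : ℕ} (hk : k < N) : (carry N k).symm 1 = site N k := by
  rw [Equiv.symm_apply_eq, carry_site_self hk]

variable [NeZero N]

theorem turn_one : turn N 1 = 1 := by
  have hN := NeZero.pos N
  rw [turn, Equiv.Perm.mul_apply, zero_add, Equiv.swap_apply_right, ← site_last,
    carry_site_self (by omega)]

theorem turn_site {t : ℕ} (h1 : 1 ≤ t) (ht : t + 1 < N) : turn N (site N t) = site N (t + 1) := by
  rw [turn, Equiv.Perm.mul_apply, zero_add, Equiv.swap_apply_of_ne_of_ne,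
    carry_site (by omega) (by omega), if_pos (by omega)]
  · rw [← site_last, Ne, site_inj (by omega) (by omega)]; omega
  · rw [← site_zero, Ne, site_inj (by omega) (by omega)]; omega

theorem turn_site_last (hN : 2 ≤ N) : turn N (site N (N - 1)) = site N 1 := by
  rw [turn, Equiv.Perm.mul_apply, zero_add, site_last, Equiv.swap_apply_left,
    carry_one (by omega) (by omega)]

theorem holes_comp (c : Conf N) (π : Equiv.Perm (ZMod N)) : holes (c ∘ π) = holes c := by
  unfold holes
  refine Finset.card_bij' (fun j _ => π j) (fun j _ => π.symm j) (fun j hj => ?_) (fun j hj => ?_)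
    (by simp) (by simp)
  · exact Finset.mem_filter.2 ⟨Finset.mem_univ _, (Finset.mem_filter.1 hj).2⟩
  · refine Finset.mem_filter.2 ⟨Finset.mem_univ _, ?_⟩
    rw [Function.comp_apply, Equiv.apply_symm_apply]
    exact (Finset.mem_filter.1 hj).2

theorem holes_update {c : Conf N} {j : ZMod N} {x : Fin 3} (hc : c j ≠ 2) (hx : x ≠ 2) :
    holes (Function.update c j x) = holes c := by
  unfold holes
  congr 1
  ext i
  by_cases hi : i = j
  · subst hi; simp [hc, hx]
  · simp [hi]

theorem eq_of_holes_eq_one {c : Conf N} (h : holes c = 1) {i j : ZMod N} (hi : c i = 2)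
    (hj : c j = 2) : i = j :=
  Finset.card_le_one.1 h.le i (by simpa using hi) j (by simpa using hj)

theorem selfEnergy_of_holes_eq_one (hN : 2 ≤ N) (V₁ : ℝ) {c : Conf N} (h : holes c = 1) :
    selfEnergy V₁ c = 0 := by
  have : adjHoles c = 0 := by
    unfold adjHoles
    rw [Finset.card_eq_zero, Finset.filter_eq_empty_iff]
    rintro i - ⟨h1, h2⟩
    have h3 := eq_of_holes_eq_one h h1 h2
    have : Fact (1 < N) := ⟨hN⟩
    exact one_ne_zero (left_eq_add.1 h3)
  rw [selfEnergy, h, this]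
  push_cast
  ring

theorem sum_range_hole (c : Conf N) (x : ℝ) :
    ∑ k ∈ Finset.range N, (if c (site N k) = 2 then x else 0) = holes c * x := by
  have h : ∑ k ∈ Finset.range N, (if c (site N k) = 2 then x else 0)
      = ∑ i : ZMod N, (if c i = 2 then x else 0) := by
    refine Finset.sum_bij' (fun k _ => site N k) (fun i _ => pos i) (by simp) ?_ ?_ ?_ ?_
    · intro i _; exact Finset.mem_range.2 (pos_lt i)
    · intro k hk; exact pos_site (Finset.mem_range.1 hk)
    · intro i _; exact site_pos i
    · intro k _; rfl
  rw [h, ← Finset.sum_filter, Finset.sum_const, nsmul_eq_mul, holes]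

theorem sum_comp_perm {β : Type*} [AddCommMonoid β] (π ρ : Equiv.Perm (ZMod N))
    (F : Conf N × Conf N → β) : ∑ s : Conf N × Conf N, F (s.1 ∘ π, s.2 ∘ ρ) = ∑ s, F s := by
  refine Finset.sum_nbij' (fun s => (s.1 ∘ π, s.2 ∘ ρ)) (fun s => (s.1 ∘ π.symm, s.2 ∘ ρ.symm))
    (by simp) (by simp) ?_ ?_ (fun _ _ => rfl)
  · intro s _; ext <;> simp
  · intro s _; ext <;> simp

theorem sum_both_holes {k l : ℕ} (hk : k < N) (hl : l < N) (F : Conf N × Conf N → ℝ) :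
    ∑ s : Conf N × Conf N, (if s.1 (site N k) = 2 ∧ s.2 (site N l) = 2 then F s else 0)
      = ∑ s : Conf N × Conf N, if s.1 1 = 2 ∧ s.2 1 = 2 then
          F (s.1 ∘ carry N k, s.2 ∘ carry N l) else 0 := by
  rw [← sum_comp_perm (carry N k) (carry N l)]
  simp only [Function.comp_apply, carry_site_self hk, carry_site_self hl]

/-- When the right ring has exactly one hole, the indicators of its possible positions add up to 1
and can be inserted into the sum. -/
theorem sum_left_hole {k : ℕ} (hk : k < N) (F : Conf N × Conf N → ℝ)
    (hF : ∀ s, holes s.2 ≠ 1 → F s = 0) :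
    ∑ s : Conf N × Conf N, (if s.1 (site N k) = 2 then F s else 0)
      = ∑ l ∈ Finset.range N, ∑ s : Conf N × Conf N, if s.1 1 = 2 ∧ s.2 1 = 2 then
          F (s.1 ∘ carry N k, s.2 ∘ carry N l) else 0 := by
  rw [Finset.sum_congr rfl fun l hl => (sum_both_holes hk (Finset.mem_range.1 hl) F).symm,
    Finset.sum_comm]
  refine Finset.sum_congr rfl fun s _ => ?_
  have h : ∀ l, (if s.1 (site N k) = 2 ∧ s.2 (site N l) = 2 then F s else 0)
      = if s.2 (site N l) = 2 then (if s.1 (site N k) = 2 then F s else 0) else 0 := by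
    intro l
    by_cases h1 : s.1 (site N k) = 2 <;> by_cases h2 : s.2 (site N l) = 2 <;> simp [h1, h2]
  simp_rw [h]
  rw [sum_range_hole]
  by_cases h1 : holes s.2 = 1
  · rw [h1]; simp
  · rw [hF s h1]; simp

theorem sum_right_hole {l : ℕ} (hl : l < N) (F : Conf N × Conf N → ℝ)
    (hF : ∀ s, holes s.1 ≠ 1 → F s = 0) :
    ∑ s : Conf N × Conf N, (if s.2 (site N l) = 2 then F s else 0)
      = ∑ k ∈ Finset.range N, ∑ s : Conf N × Conf N, if s.1 1 = 2 ∧ s.2 1 = 2 then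
          F (s.1 ∘ carry N k, s.2 ∘ carry N l) else 0 := by
  rw [Finset.sum_congr rfl fun k hk => (sum_both_holes (Finset.mem_range.1 hk) hl F).symm,
    Finset.sum_comm]
  refine Finset.sum_congr rfl fun s _ => ?_
  simp_rw [ite_and]
  rw [sum_range_hole]
  by_cases h1 : holes s.1 = 1
  · rw [h1]; simp
  · rw [hF s h1]; simp

theorem sum_sector (F : Conf N × Conf N → ℝ) (hF : ∀ s, ¬(holes s.1 = 1 ∧ holes s.2 = 1) → F s = 0) :
    ∑ s, F s = ∑ k ∈ Finset.range N, ∑ l ∈ Finset.range N, ∑ s : Conf N × Conf N,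
      if s.1 1 = 2 ∧ s.2 1 = 2 then F (s.1 ∘ carry N k, s.2 ∘ carry N l) else 0 := by
  rw [Finset.sum_congr rfl fun k hk => (sum_left_hole (Finset.mem_range.1 hk) F
    fun s hs => hF s fun h => hs h.2).symm, Finset.sum_comm]
  refine Finset.sum_congr rfl fun s _ => ?_
  rw [sum_range_hole]
  by_cases h1 : holes s.1 = 1
  · rw [h1]; simp
  · rw [hF s fun h => h1 h.1]; simp

end Transport

/-! ### The field on the grid, singlet projectors and the rotation. -/

section Field

variable {N : ℕ}

theorem update_comp_perm (c : Conf N) (j : ZMod N) (x : Fin 3) (π : Equiv.Perm (ZMod N)) :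
    Function.update c (π j) x ∘ π = Function.update (c ∘ π) j x :=
  Function.update_comp_eq_of_injective _ π.injective _ _

/-- Amplitudes on the configurations with the holes at the positions `k`, `l`, transported to the
configurations with both holes at the site `1`. -/
def field (ψ : Conf N × Conf N → ℂ) (k l : ℕ) : EuclideanSpace ℂ (Conf N × Conf N) :=
  WithLp.toLp 2 fun s =>
    if s.1 1 = 2 ∧ s.2 1 = 2 then ψ (s.1 ∘ carry N k, s.2 ∘ carry N l) else 0

theorem field_apply (ψ : Conf N × Conf N → ℂ) (k l : ℕ) (s : Conf N × Conf N) :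
    field ψ k l s = if s.1 1 = 2 ∧ s.2 1 = 2 then ψ (s.1 ∘ carry N k, s.2 ∘ carry N l) else 0 := rfl

/-- Precomposition with a permutation of the sites of both rings. -/
def permute (π : Equiv.Perm (ZMod N)) :
    EuclideanSpace ℂ (Conf N × Conf N) →ₗ[ℂ] EuclideanSpace ℂ (Conf N × Conf N) where
  toFun w := WithLp.toLp 2 fun s => w (s.1 ∘ π, s.2 ∘ π)
  map_add' _ _ := rfl
  map_smul' _ _ := rfl

theorem permute_apply (π : Equiv.Perm (ZMod N)) (w : EuclideanSpace ℂ (Conf N × Conf N))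
    (s : Conf N × Conf N) : permute π w s = w (s.1 ∘ π, s.2 ∘ π) := rfl

variable [NeZero N]

/-- `pairProj` as an operator. -/
def pairOp (j : ZMod N) :
    EuclideanSpace ℂ (Conf N × Conf N) →ₗ[ℂ] EuclideanSpace ℂ (Conf N × Conf N) :=
  Matrix.toEuclideanLin (pairProj j)

theorem pairOp_apply (j : ZMod N) (w : EuclideanSpace ℂ (Conf N × Conf N)) (s : Conf N × Conf N) :
    pairOp j w s = singlet (s.1 j) (s.2 j) * ∑ x, ∑ y, singlet x y *
      w (Function.update s.1 j x, Function.update s.2 j y) := pairProj_mulVec j w.ofLp s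

theorem norm_pairOp_le (j : ZMod N) (w : EuclideanSpace ℂ (Conf N × Conf N)) :
    ‖pairOp j w‖ ≤ ‖w‖ := by
  refine le_of_sq_le_sq ?_ (norm_nonneg _)
  rw [EuclideanSpace.norm_sq_eq, EuclideanSpace.norm_sq_eq]
  exact sum_norm_sq_proj_le (pairProj_isHermitian j) (pairProj_mul_self j) w.ofLp

theorem norm_permute (π : Equiv.Perm (ZMod N)) (w : EuclideanSpace ℂ (Conf N × Conf N)) :
    ‖permute π w‖ = ‖w‖ := by
  rw [← sq_eq_sq₀ (norm_nonneg _) (norm_nonneg _), EuclideanSpace.norm_sq_eq,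
    EuclideanSpace.norm_sq_eq]
  exact sum_comp_perm π π fun s => ‖w s‖ ^ 2

theorem pairOp_pairOp (j : ZMod N) (w : EuclideanSpace ℂ (Conf N × Conf N)) :
    pairOp j (pairOp j w) = pairOp j w := by
  apply WithLp.ofLp_injective
  change pairProj j *ᵥ (pairProj j *ᵥ w.ofLp) = pairProj j *ᵥ w.ofLp
  rw [mulVec_mulVec, pairProj_mul_self]

theorem pairOp_comm {i j : ZMod N} (hij : i ≠ j) (w : EuclideanSpace ℂ (Conf N × Conf N)) :
    pairOp i (pairOp j w) = pairOp j (pairOp i w) := by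
  apply WithLp.ofLp_injective
  change pairProj i *ᵥ (pairProj j *ᵥ w.ofLp) = pairProj j *ᵥ (pairProj i *ᵥ w.ofLp)
  rw [mulVec_mulVec, mulVec_mulVec, pairProj_mul_comm hij]

theorem pairOp_permute (j : ZMod N) (π : Equiv.Perm (ZMod N))
    (w : EuclideanSpace ℂ (Conf N × Conf N)) :
    pairOp (π j) (permute π w) = permute π (pairOp j w) := by
  ext s
  rw [pairOp_apply, permute_apply, pairOp_apply]
  simp only [permute_apply, update_comp_perm, Function.comp_apply]

/-- The state with both holes at the site `1` and singlets elsewhere. -/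
def singletState (N : ℕ) [NeZero N] : EuclideanSpace ℂ (Conf N × Conf N) :=
  WithLp.toLp 2 fun s => if s.1 1 = 2 ∧ s.2 1 = 2 then
    ∏ j ∈ Finset.univ.erase 1, singlet (s.1 j) (s.2 j) else 0

theorem singletState_apply (s : Conf N × Conf N) : singletState N s =
    if s.1 1 = 2 ∧ s.2 1 = 2 then ∏ j ∈ Finset.univ.erase 1, singlet (s.1 j) (s.2 j) else 0 := rfl

/-- Each invariance splits off one singlet factor, leaving a function that no longer depends on that
pair of sites; induction removes the pairs one by one. -/
theorem eq_prod_mul_of_pairOp_eq {w : EuclideanSpace ℂ (Conf N × Conf N)} (A : Finset (ZMod N))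
    (hw : ∀ j ∈ A, pairOp j w = w) :
    ∃ Φ : Conf N × Conf N → ℂ, (∀ s, w s = (∏ j ∈ A, singlet (s.1 j) (s.2 j)) * Φ s) ∧
      ∀ s t : Conf N × Conf N, (∀ j ∉ A, s.1 j = t.1 j ∧ s.2 j = t.2 j) → Φ s = Φ t := by
  induction A using Finset.induction_on with
  | empty =>
    refine ⟨w.ofLp, fun s => by simp, fun s t hst => ?_⟩
    rw [show s = t from Prod.ext (funext fun j => (hst j (by simp)).1)
      (funext fun j => (hst j (by simp)).2)]
  | insert j A hj ih =>
    obtain ⟨Φ, h1, h2⟩ := ih fun i hi => hw i (Finset.mem_insert_of_mem hi)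
    refine ⟨fun s => ∑ x, ∑ y, singlet x y *
      Φ (Function.update s.1 j x, Function.update s.2 j y), fun s => ?_, fun s t hst => ?_⟩
    · conv_lhs => rw [← hw j (Finset.mem_insert_self _ _)]
      rw [pairOp_apply, Finset.prod_insert hj, mul_assoc]
      congr 1
      rw [Finset.mul_sum]
      refine Finset.sum_congr rfl fun x _ => ?_
      rw [Finset.mul_sum]
      refine Finset.sum_congr rfl fun y _ => ?_
      rw [h1]
      have : ∏ i ∈ A, singlet (Function.update s.1 j x i) (Function.update s.2 j y i)
          = ∏ i ∈ A, singlet (s.1 i) (s.2 i) := by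
        refine Finset.prod_congr rfl fun i hi => ?_
        have : i ≠ j := fun h => hj (h ▸ hi)
        rw [Function.update_of_ne this, Function.update_of_ne this]
      rw [this]
      ring
    · refine Finset.sum_congr rfl fun x _ => Finset.sum_congr rfl fun y _ => ?_
      congr 1
      apply h2
      intro i hi
      by_cases hij : i = j
      · subst hij; simp
      · simp only [Function.update_of_ne hij]
        exact hst i (by simp [hij, hi])

/-- The remaining factor depends only on the sites 1, which the support condition fixes to be holes,
so it is a constant. -/
theorem eq_smul_singletState {w : EuclideanSpace ℂ (Conf N × Conf N)}
    (hw : ∀ j ≠ 1, pairOp j w = w) (hsupp : ∀ s, ¬(s.1 1 = 2 ∧ s.2 1 = 2) → w s = 0) :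
    ∃ z : ℂ, w = z • singletState N := by
  obtain ⟨Φ, h1, h2⟩ := eq_prod_mul_of_pairOp_eq (Finset.univ.erase 1)
    fun j hj => hw j (Finset.ne_of_mem_erase hj)
  refine ⟨Φ (fun _ => 2, fun _ => 2), ?_⟩
  ext s
  rw [PiLp.smul_apply, singletState_apply]
  split_ifs with hs
  · rw [h1 s, smul_eq_mul, mul_comm]
    congr 1
    apply h2
    intro j hj
    have : j = 1 := by simpa using hj
    subst this
    exact hs
  · rw [hsupp s hs, smul_zero]

theorem pairOp_singletState {j : ZMod N} (hj : j ≠ 1) :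
    pairOp j (singletState N) = singletState N := by
  ext s
  have hmem : j ∈ Finset.univ.erase (1 : ZMod N) := by simp [hj]
  rw [pairOp_apply]
  simp only [singletState_apply, Function.update_of_ne hj.symm]
  split_ifs with hs
  · have : ∀ x y, ∏ i ∈ Finset.univ.erase (1 : ZMod N),
        singlet (Function.update s.1 j x i) (Function.update s.2 j y i)
        = singlet x y * ∏ i ∈ (Finset.univ.erase (1 : ZMod N)).erase j,
          singlet (s.1 i) (s.2 i) := by
      intro x y
      rw [← Finset.mul_prod_erase _ _ hmem, Function.update_self, Function.update_self]
      congr 1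
      refine Finset.prod_congr rfl fun i hi => ?_
      have : i ≠ j := Finset.ne_of_mem_erase hi
      rw [Function.update_of_ne this, Function.update_of_ne this]
    simp_rw [this]
    rw [← Finset.mul_prod_erase _ _ hmem]
    congr 1
    simp_rw [← mul_assoc, ← Finset.sum_mul]
    rw [sum_singlet_sq, one_mul]
  · simp

theorem permute_singletState {π : Equiv.Perm (ZMod N)} (h1 : π 1 = 1) :
    permute π (singletState N) = singletState N := by
  ext s
  rw [permute_apply, singletState_apply, singletState_apply]
  simp only [Function.comp_apply, h1]
  congr 1
  refine Finset.prod_bij' (fun j _ => π j) (fun j _ => π.symm j) ?_ ?_ ?_ ?_ ?_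
  · intro j hj
    simp only [Finset.mem_erase, Finset.mem_univ, and_true] at *
    rwa [← h1, Ne, π.injective.eq_iff]
  · intro j hj
    simp only [Finset.mem_erase, Finset.mem_univ, and_true] at *
    rwa [Ne, Equiv.symm_apply_eq, h1]
  · simp
  · simp
  · intro j _; rfl

/-- One step of the rotation followed by the projection of the new neighbours of the holes. -/
def rotor (N : ℕ) [NeZero N] :
    EuclideanSpace ℂ (Conf N × Conf N) →ₗ[ℂ] EuclideanSpace ℂ (Conf N × Conf N) :=
  pairOp (site N 1) * permute (turn N).symm

theorem turn_symm_one : (turn N).symm 1 = 1 := by rw [Equiv.symm_apply_eq, turn_one]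

/-- Singlets accumulate. A step carries a singlet from `site N (t + 1)` to `site N t`, or from `site
N 1` to `site N (N - 1)`, and then projects at `site N 1`; this projector commutes with those of the
other pairs. After n + 1 steps the indices 1 and N - n, …, N - 1 are settled. -/
theorem pairOp_rotor_pow (hN : 2 ≤ N) (w : EuclideanSpace ℂ (Conf N × Conf N)) (n : ℕ)
    (t : ℕ) (ht : t = 1 ∨ (N < n + 1 + t ∧ 1 ≤ t ∧ t < N)) :
    pairOp (site N t) ((rotor N ^ (n + 1)) w) = (rotor N ^ (n + 1)) w := by
  induction n generalizing t with
  | zero =>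
    obtain rfl : t = 1 := by omega
    rw [zero_add, pow_one, rotor, Module.End.mul_apply, pairOp_pairOp]
  | succ n ih =>
    rw [pow_succ', Module.End.mul_apply]
    generalize (rotor N ^ (n + 1)) w = v at ih
    rw [rotor, Module.End.mul_apply]
    by_cases h1 : t = 1
    · subst h1; rw [pairOp_pairOp]
    · have hne : site N t ≠ site N 1 := by
        rw [Ne, site_inj (by omega) (by omega)]; exact h1
      obtain ⟨t', ht', he⟩ : ∃ t', (t' = 1 ∨ (N < n + 1 + t' ∧ 1 ≤ t' ∧ t' < N)) ∧
          site N t = (turn N).symm (site N t') := by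
        by_cases hlast : t + 1 < N
        · refine ⟨t + 1, Or.inr (by omega), ?_⟩
          rw [Equiv.eq_symm_apply, turn_site (by omega) hlast]
        · refine ⟨1, Or.inl rfl, ?_⟩
          rw [Equiv.eq_symm_apply, show t = N - 1 by omega, turn_site_last hN]
      rw [pairOp_comm hne, he, pairOp_permute, ih t' ht']

theorem rotor_pow_supp (hN : 2 ≤ N) (w : EuclideanSpace ℂ (Conf N × Conf N))
    (hw : ∀ s, ¬(s.1 1 = 2 ∧ s.2 1 = 2) → w s = 0) (n : ℕ) :
    ∀ s, ¬(s.1 1 = 2 ∧ s.2 1 = 2) → (rotor N ^ n) w s = 0 := by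
  induction n with
  | zero => exact hw
  | succ n ih =>
    intro s hs
    have hne : (1 : ZMod N) ≠ site N 1 := by
      rw [← site_zero, Ne, site_inj (by omega) (by omega)]; omega
    rw [pow_succ', Module.End.mul_apply]
    generalize (rotor N ^ n) w = v at ih
    rw [rotor, Module.End.mul_apply, pairOp_apply]
    refine mul_eq_zero_of_right _ (Finset.sum_eq_zero fun x _ => Finset.sum_eq_zero fun y _ => ?_)
    rw [permute_apply, ih, mul_zero]
    simpa only [Function.comp_apply, turn_symm_one, Function.update_of_ne hne] using hs

theorem exists_rotor_pow_eq (hN : 2 ≤ N) (w : EuclideanSpace ℂ (Conf N × Conf N))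
    (hw : ∀ s, ¬(s.1 1 = 2 ∧ s.2 1 = 2) → w s = 0) :
    ∃ z : ℂ, (rotor N ^ (N - 1)) w = z • singletState N := by
  refine eq_smul_singletState (fun j hj => ?_) (rotor_pow_supp hN w hw _)
  have h0 : pos j ≠ 0 := by
    intro h
    apply hj
    rw [← site_pos j, h, site_zero]
  have h1 := pos_lt j
  have := pairOp_rotor_pow hN w (N - 2) (pos j) (by omega)
  rwa [show N - 2 + 1 = N - 1 by omega, site_pos] at this

end Field

/-! ### The Hamiltonian as an energy on the grid, one hole in each ring. -/

section SectorForm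

variable {N : ℕ}

theorem site_one_ne (hN : 2 ≤ N) : (1 : ZMod N) ≠ site N 1 := by
  rw [← site_zero, Ne, site_inj (by omega) (by omega)]; omega

variable [NeZero N]

theorem norm_field_combination_sq (ψ χ : Conf N × Conf N → ℂ) (k l k' l' : ℕ) :
    ‖field ψ k l - field χ k' l'‖ ^ 2 = ∑ s : Conf N × Conf N, if s.1 1 = 2 ∧ s.2 1 = 2 then
      ‖ψ (s.1 ∘ carry N k, s.2 ∘ carry N l) - χ (s.1 ∘ carry N k', s.2 ∘ carry N l')‖ ^ 2 else 0 := by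
  rw [EuclideanSpace.norm_sq_eq]
  refine Finset.sum_congr rfl fun s _ => ?_
  rw [PiLp.sub_apply, field_apply, field_apply]
  split_ifs <;> simp

theorem norm_field_sq (ψ : Conf N × Conf N → ℂ) (k l : ℕ) :
    ‖field ψ k l‖ ^ 2 = ∑ s : Conf N × Conf N, if s.1 1 = 2 ∧ s.2 1 = 2 then
      ‖ψ (s.1 ∘ carry N k, s.2 ∘ carry N l)‖ ^ 2 else 0 := by
  rw [EuclideanSpace.norm_sq_eq]
  refine Finset.sum_congr rfl fun s _ => ?_
  rw [field_apply]
  split_ifs <;> simp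

/-- States with one hole in each ring. -/
def InSector (ψ : Conf N × Conf N → ℂ) : Prop :=
  ∀ s, ¬(holes s.1 = 1 ∧ holes s.2 = 1) → ψ s = 0

theorem InSector.sum_norm_sq {ψ : Conf N × Conf N → ℂ} (h : InSector ψ) :
    ∑ s, ‖ψ s‖ ^ 2 = ∑ k ∈ Finset.range N, ∑ l ∈ Finset.range N, ‖field ψ k l‖ ^ 2 := by
  simp_rw [norm_field_sq]
  exact sum_sector (fun s => ‖ψ s‖ ^ 2) fun s hs => by rw [h s hs]; simp

theorem InSector.sum_left {ψ : Conf N × Conf N → ℂ} (h : InSector ψ) :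
    ∑ s : Conf N × Conf N, ∑ i ∈ Finset.univ.erase (0 : ZMod N),
      (if s.1 i = 2 then ‖ψ s - ψ (sw i s.1, s.2)‖ ^ 2 else 0)
      = ∑ k ∈ Finset.range (N - 1), ∑ l ∈ Finset.range N,
        ‖field ψ (k + 1) l - field ψ k l‖ ^ 2 := by
  simp_rw [sum_erase_zero]
  rw [Finset.sum_comm]
  refine Finset.sum_congr rfl fun k hk => ?_
  rw [Finset.mem_range] at hk
  rw [sum_left_hole (by omega) fun s => ‖ψ s - ψ (sw (site N k) s.1, s.2)‖ ^ 2]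
  · simp_rw [norm_sub_rev (field ψ (k + 1) _), norm_field_combination_sq, comp_carry_succ]
  · intro s hs
    rw [h s fun h => hs h.2, h (sw (site N k) s.1, s.2) fun h => hs h.2]
    simp

theorem InSector.sum_right {ψ : Conf N × Conf N → ℂ} (h : InSector ψ) :
    ∑ s : Conf N × Conf N, ∑ i ∈ Finset.univ.erase (0 : ZMod N),
      (if s.2 i = 2 then ‖ψ s - ψ (s.1, sw i s.2)‖ ^ 2 else 0)
      = ∑ k ∈ Finset.range N, ∑ l ∈ Finset.range (N - 1),
        ‖field ψ k (l + 1) - field ψ k l‖ ^ 2 := by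
  simp_rw [sum_erase_zero]
  rw [Finset.sum_comm, Finset.sum_comm (s := Finset.range N)]
  refine Finset.sum_congr rfl fun l hl => ?_
  rw [Finset.mem_range] at hl
  rw [sum_right_hole (by omega) fun s => ‖ψ s - ψ (s.1, sw (site N l) s.2)‖ ^ 2]
  · simp_rw [norm_sub_rev (field ψ _ (l + 1)), norm_field_combination_sq, comp_carry_succ]
  · intro s hs
    rw [h s fun h => hs h.1, h (s.1, sw (site N l) s.2) fun h => hs h.1]
    simp

/-- Both holes at the last site means the far corner; the exchange with site 1 completes each
transport to the full `turn`, which is the twist in the gluing. -/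
theorem sum_joint (ψ : Conf N × Conf N → ℂ) :
    ∑ s : Conf N × Conf N,
      (if s.1 0 = 2 ∧ s.2 0 = 2 then ‖ψ s - ψ (sw 0 s.1, sw 0 s.2)‖ ^ 2 else 0)
      = ‖field ψ 0 0 - permute (turn N).symm (field ψ (N - 1) (N - 1))‖ ^ 2 := by
  have hN := NeZero.pos N
  have h := sum_both_holes (k := N - 1) (l := N - 1) (by omega) (by omega)
    fun s => ‖ψ s - ψ (sw 0 s.1, sw 0 s.2)‖ ^ 2
  rw [site_last] at h
  rw [h, EuclideanSpace.norm_sq_eq]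
  conv_rhs => rw [← sum_comp_perm (turn N) (turn N)]
  refine Finset.sum_congr rfl fun s _ => ?_
  rw [PiLp.sub_apply, permute_apply, field_apply, field_apply]
  have h1 : ∀ c : Conf N, (c ∘ turn N) ∘ (turn N).symm = c := by
    intro c; funext j; simp
  have h2 : ∀ c : Conf N, (c ∘ turn N) ∘ carry N 0 = c ∘ turn N := fun c => rfl
  simp only [h1, h2]
  have h3 : ∀ c : Conf N, (c ∘ turn N) 1 = c 1 := fun c => by rw [Function.comp_apply, turn_one]
  simp only [h3]
  split_ifs
  · rw [norm_sub_rev]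
    rfl
  · simp

theorem InSector.HP_mulVec {ψ : Conf N × Conf N → ℂ} (h : InSector ψ) :
    InSector (HP N *ᵥ ψ) := by
  intro s hs
  rw [TwoRing.HP_mulVec, h s hs, ite_self, zero_sub, neg_eq_zero, pairProj_mulVec]
  by_cases h1 : s.1 1 = 2
  · rw [h1, singlet_two_left, zero_mul]
  by_cases h2 : s.2 1 = 2
  · rw [h2, singlet_two_right, zero_mul]
  refine mul_eq_zero_of_right _ (Finset.sum_eq_zero fun x _ => Finset.sum_eq_zero fun y _ => ?_)
  by_cases hx : x = 2
  · rw [hx, singlet_two_left, zero_mul]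
  by_cases hy : y = 2
  · rw [hy, singlet_two_right, zero_mul]
  rw [h, mul_zero]
  simpa only [holes_update h1 hx, holes_update h2 hy] using hs

/-- A transport by at least one step sends site 1 to `site N 1`, so the constraint always acts on
that same pair. The part of `HP` requiring no hole there acts as the identity, because the only hole
of each ring is elsewhere. -/
theorem InSector.field_HP {ψ : Conf N × Conf N → ℂ} (h : InSector ψ) {k l : ℕ}
    (hk0 : 0 < k) (hk : k < N) (hl0 : 0 < l) (hl : l < N) :
    field (HP N *ᵥ ψ) k l = field ψ k l - pairOp (site N 1) (field ψ k l) := by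
  have hN : 2 ≤ N := by omega
  have hne := site_one_ne hN
  ext s
  rw [PiLp.sub_apply, pairOp_apply, field_apply, field_apply]
  simp only [field_apply, Function.update_of_ne hne]
  split_ifs with hs
  · rw [TwoRing.HP_mulVec, pairProj_mulVec]
    have hup : ∀ (c : Conf N) (x : Fin 3) {m : ℕ}, 0 < m → m < N →
        Function.update (c ∘ carry N m) 1 x = Function.update c (site N 1) x ∘ carry N m := by
      intro c x m hm0 hm
      rw [← carry_one hm hm0, update_comp_perm]
    simp only [Function.comp_apply, carry_one hk hk0, carry_one hl hl0]
    congr 1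
    · rw [ite_eq_left_iff]
      intro hcon
      refine (h _ fun hh => hcon ?_).symm
      have key : ∀ (c : Conf N) {m : ℕ}, 0 < m → m < N → c 1 = 2 →
          holes (c ∘ carry N m) = 1 → c (site N 1) ≠ 2 := by
        intro c m _ _ hc hh h2
        rw [holes_comp] at hh
        exact hne (eq_of_holes_eq_one hh hc h2)
      exact ⟨key _ hk0 hk hs.1 hh.1, key _ hl0 hl hs.2 hh.2⟩
    · congr 1
      refine Finset.sum_congr rfl fun x _ => Finset.sum_congr rfl fun y _ => ?_
      rw [hup _ _ hk0 hk, hup _ _ hl0 hl]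
  · simp

theorem field_HP_zero (ψ : Conf N × Conf N → ℂ) {k l : ℕ} (h0 : k = 0 ∨ l = 0) :
    field (HP N *ᵥ ψ) k l = 0 := by
  ext s
  rw [field_apply, PiLp.zero_apply, ite_eq_right_iff]
  intro hs
  rw [TwoRing.HP_mulVec, pairProj_mulVec]
  rcases h0 with rfl | rfl
  · have : (s.1 ∘ carry N 0) 1 = 2 := hs.1
    simp only [this]
    simp [singlet_two_left]
  · have : (s.2 ∘ carry N 0) 1 = 2 := hs.2
    simp only [this]
    simp [singlet_two_right]

theorem InSector.sum_HP {ψ : Conf N × Conf N → ℂ} (h : InSector ψ) :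
    ∑ s, ‖(HP N *ᵥ ψ) s‖ ^ 2 = ∑ k ∈ Finset.range (N - 1), ∑ l ∈ Finset.range (N - 1),
      ‖field ψ (k + 1) (l + 1) - pairOp (site N 1) (field ψ (k + 1) (l + 1))‖ ^ 2 := by
  rw [h.HP_mulVec.sum_norm_sq]
  have hN : N = N - 1 + 1 := (Nat.sub_add_cancel NeZero.one_le).symm
  have e : Finset.range N = Finset.range (N - 1 + 1) := by rw [← hN]
  rw [e, Finset.sum_range_succ']
  simp_rw [Finset.sum_range_succ' _ (N - 1)]
  simp only [field_HP_zero ψ (Or.inl rfl), field_HP_zero ψ (Or.inr rfl), norm_zero,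
    ne_eq, OfNat.ofNat_ne_zero, not_false_eq_true, zero_pow, Finset.sum_const_zero, add_zero]
  refine Finset.sum_congr rfl fun k hk => Finset.sum_congr rfl fun l hl => ?_
  rw [Finset.mem_range] at hk hl
  rw [h.field_HP (by omega) (by omega) (by omega) (by omega)]

theorem InSector.sum_density (hN : 2 ≤ N) (V₁ : ℝ) {ψ : Conf N × Conf N → ℂ} (h : InSector ψ) :
    ∑ s, density V₁ ψ s = gridEnergy N (field ψ)
      + ‖field ψ 0 0 - permute (turn N).symm (field ψ (N - 1) (N - 1))‖ ^ 2
      + ∑ k ∈ Finset.range (N - 1), ∑ l ∈ Finset.range (N - 1),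
        ‖field ψ (k + 1) (l + 1) - pairOp (site N 1) (field ψ (k + 1) (l + 1))‖ ^ 2 := by
  have hpot : ∀ s : Conf N × Conf N, selfEnergy V₁ s.1 * ‖ψ s‖ ^ 2 = 0
      ∧ selfEnergy V₁ s.2 * ‖ψ s‖ ^ 2 = 0 := by
    intro s
    by_cases hs : holes s.1 = 1 ∧ holes s.2 = 1
    · rw [selfEnergy_of_holes_eq_one hN _ hs.1, selfEnergy_of_holes_eq_one hN _ hs.2]
      simp
    · rw [h s hs]
      simp
  unfold density ringEnergy couplingEnergy
  simp only [Prod.mk.eta, (hpot _).1, (hpot _).2, add_zero]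
  rw [Finset.sum_add_distrib, Finset.sum_add_distrib, Finset.sum_add_distrib, h.sum_left,
    h.sum_right, sum_joint, h.sum_HP, gridEnergy]
  ring

end SectorForm

/-! ### The ground state and the gap within the one-hole sector. -/

section Ground

variable {N : ℕ}

theorem comp_carry_comp_symm (c : Conf N) (k : ℕ) : (c ∘ carry N k) ∘ (carry N k).symm = c := by
  funext j; simp

variable [NeZero N]

/-- The ground state: both holes in the uniform superposition of all positions. -/
def ground (N : ℕ) [NeZero N] (s : Conf N × Conf N) : ℂ :=
  ∑ k ∈ Finset.range N, ∑ l ∈ Finset.range N,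
    singletState N (s.1 ∘ (carry N k).symm, s.2 ∘ (carry N l).symm)

theorem holes_eq_one_of_forall {c : Conf N} (h1 : c 1 = 2) (h : ∀ j ≠ 1, c j ≠ 2) :
    holes c = 1 := by
  unfold holes
  rw [Finset.card_eq_one]
  refine ⟨1, ?_⟩
  ext j
  rw [Finset.mem_filter, Finset.mem_singleton]
  constructor
  · rintro ⟨-, hj⟩
    by_contra hne
    exact h j hne hj
  · rintro rfl
    exact ⟨Finset.mem_univ _, h1⟩

theorem singletState_inSector : InSector (singletState N).ofLp := by
  intro s hs
  rw [singletState_apply, ite_eq_right_iff]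
  intro h
  by_contra hne
  rw [Finset.prod_eq_zero_iff, not_exists] at hne
  have hne' : ∀ j ≠ (1 : ZMod N), singlet (s.1 j) (s.2 j) ≠ 0 := by
    intro j hj h0
    exact hne j ⟨by simp [hj], h0⟩
  refine hs ⟨holes_eq_one_of_forall h.1 fun j hj h2 => ?_,
    holes_eq_one_of_forall h.2 fun j hj h2 => ?_⟩
  · exact hne' j hj (by rw [h2, singlet_two_left])
  · exact hne' j hj (by rw [h2, singlet_two_right])

theorem ground_inSector : InSector (ground N) := by
  intro s hs
  refine Finset.sum_eq_zero fun k _ => Finset.sum_eq_zero fun l _ => ?_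
  apply singletState_inSector
  simpa only [holes_comp] using hs

theorem holes_ne_one {c : Conf N} {k k' : ℕ} (hk : k < N) (hk' : k' < N) (hne : k' ≠ k)
    (h1 : ((c ∘ carry N k) ∘ (carry N k').symm) 1 = 2) (h2 : c 1 = 2) :
    holes ((c ∘ carry N k) ∘ (carry N k').symm) ≠ 1 := by
  intro h
  rw [holes_comp] at h
  rw [Function.comp_apply, carry_symm_one hk'] at h1
  have h3 : (c ∘ carry N k) (site N k) = 2 := by
    rw [Function.comp_apply, carry_site_self hk, h2]
  exact hne ((site_inj hk' hk).1 (eq_of_holes_eq_one h h1 h3))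

/-- In a nonzero amplitude each ring has only one hole, so only the term of `ground` with the
matching positions survives. -/
theorem field_ground {k l : ℕ} (hk : k < N) (hl : l < N) : field (ground N) k l = singletState N := by
  ext s
  rw [field_apply]
  split_ifs with hs
  · rw [ground, Finset.sum_eq_single_of_mem k (Finset.mem_range.2 hk),
      Finset.sum_eq_single_of_mem l (Finset.mem_range.2 hl)]
    · simp only [comp_carry_comp_symm]
    · intro l' hl' hne
      rw [Finset.mem_range] at hl'
      by_cases h1 : ((s.2 ∘ carry N l) ∘ (carry N l').symm) 1 = 2
      · exact singletState_inSector _ fun h => holes_ne_one hl hl' hne h1 hs.2 h.2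
      · rw [singletState_apply, if_neg fun h => h1 h.2]
    · intro k' hk' hne
      rw [Finset.mem_range] at hk'
      refine Finset.sum_eq_zero fun l' _ => ?_
      by_cases h1 : ((s.1 ∘ carry N k) ∘ (carry N k').symm) 1 = 2
      · exact singletState_inSector _ fun h => holes_ne_one hk hk' hne h1 hs.1 h.1
      · rw [singletState_apply, if_neg fun h => h1 h.1]
  · rw [singletState_apply, if_neg hs]

theorem sum_density_ground (hN : 2 ≤ N) (V₁ : ℝ) : ∑ s, density V₁ (ground N) s = 0 := by
  rw [ground_inSector.sum_density hN, gridEnergy]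
  have h1 : pairOp (site N 1) (singletState N) = singletState N :=
    pairOp_singletState (site_one_ne hN).symm
  rw [field_ground (by omega) (by omega), field_ground (k := N - 1) (by omega) (by omega),
    permute_singletState turn_symm_one]
  have e1 : ∑ k ∈ Finset.range (N - 1), ∑ l ∈ Finset.range N,
      ‖field (ground N) (k + 1) l - field (ground N) k l‖ ^ 2 = 0 := by
    refine Finset.sum_eq_zero fun k hk => Finset.sum_eq_zero fun l hl => ?_
    rw [Finset.mem_range] at hk hl
    rw [field_ground (by omega) hl, field_ground (by omega) hl]; simp
  have e2 : ∑ k ∈ Finset.range N, ∑ l ∈ Finset.range (N - 1),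
      ‖field (ground N) k (l + 1) - field (ground N) k l‖ ^ 2 = 0 := by
    refine Finset.sum_eq_zero fun k hk => Finset.sum_eq_zero fun l hl => ?_
    rw [Finset.mem_range] at hk hl
    rw [field_ground hk (by omega), field_ground hk (by omega)]; simp
  have e3 : ∑ k ∈ Finset.range (N - 1), ∑ l ∈ Finset.range (N - 1),
      ‖field (ground N) (k + 1) (l + 1) - pairOp (site N 1) (field (ground N) (k + 1) (l + 1))‖ ^ 2
      = 0 := by
    refine Finset.sum_eq_zero fun k hk => Finset.sum_eq_zero fun l hl => ?_
    rw [Finset.mem_range] at hk hl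
    rw [field_ground (by omega) (by omega), h1]; simp
  rw [e1, e2, e3]
  simp

/-- Turns orthogonality to the ground state into one condition on the field summed over the grid. -/
theorem inner_ground (ψ : Conf N × Conf N → ℂ) :
    star (ground N) ⬝ᵥ ψ
      = ∑ k ∈ Finset.range N, ∑ l ∈ Finset.range N, inner ℂ (singletState N) (field ψ k l) := by
  have h : ∀ k l, inner ℂ (singletState N) (field ψ k l)
      = ∑ s : Conf N × Conf N, star (singletState N (s.1 ∘ (carry N k).symm, s.2 ∘ (carry N l).symm))
        * ψ s := by
    intro k l
    rw [← sum_comp_perm (carry N k) (carry N l), PiLp.inner_apply]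
    refine Finset.sum_congr rfl fun s _ => ?_
    simp only [comp_carry_comp_symm]
    rw [RCLike.inner_apply, field_apply, starRingEnd_apply]
    split_ifs with hs
    · rw [mul_comm]
    · rw [singletState_apply, if_neg hs]; simp
  simp_rw [h]
  rw [dotProduct]
  simp only [Pi.star_apply, ground, star_sum, Finset.sum_mul]
  rw [Finset.sum_comm]
  refine Finset.sum_congr rfl fun k _ => ?_
  rw [Finset.sum_comm]

/-- Gap inequality in the sector with one hole in each ring. -/
theorem InSector.sum_norm_sq_le (hN : 2 ≤ N) (V₁ : ℝ) {ψ : Conf N × Conf N → ℂ} (h : InSector ψ)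
    (hψ : star (ground N) ⬝ᵥ ψ = 0) :
    ∑ s, ‖ψ s‖ ^ 2 ≤ 4000 * ((N : ℝ) ^ 4 * Real.log N) * ∑ s, density V₁ ψ s := by
  have hsupp : ∀ s : Conf N × Conf N, ¬(s.1 1 = 2 ∧ s.2 1 = 2) → field ψ 0 0 s = 0 := by
    intro s hs
    rw [field_apply, if_neg hs]
  obtain ⟨z, hz⟩ := exists_rotor_pow_eq hN (field ψ 0 0) hsupp
  have hmain := sum_norm_sub_iterate_sq_le (pairOp (site N 1)) (permute (turn N).symm)
    (norm_pairOp_le _) (fun w => (norm_permute _ w).le) hN (field ψ) _ (h.sum_density hN V₁).ge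
  change ∑ k ∈ Finset.range N, ∑ l ∈ Finset.range N,
    ‖field ψ k l - (rotor N ^ (N - 1)) (field ψ 0 0)‖ ^ 2 ≤ _ at hmain
  rw [hz] at hmain
  refine le_trans ?_ hmain
  rw [h.sum_norm_sq]
  rw [inner_ground] at hψ
  have e : ∀ k l, ‖field ψ k l - z • singletState N‖ ^ 2 = ‖field ψ k l‖ ^ 2
      - 2 * (star z * inner ℂ (singletState N) (field ψ k l)).re + ‖z • singletState N‖ ^ 2 := by
    intro k l
    rw [@norm_sub_sq ℂ, ← inner_conj_symm, inner_smul_left, RCLike.conj_re]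
    rfl
  simp_rw [e]
  -- Orthogonality kills the total cross term, so subtracting the constant field z • `singletState`
  -- cannot decrease the norm.
  have e2 : ∑ k ∈ Finset.range N, ∑ l ∈ Finset.range N,
      (star z * inner ℂ (singletState N) (field ψ k l)).re = 0 := by
    simp_rw [← Complex.re_sum, ← Finset.mul_sum]
    rw [hψ]
    simp
  simp only [Finset.sum_add_distrib, Finset.sum_sub_distrib, ← Finset.mul_sum]
  rw [e2]
  have : 0 ≤ ∑ k ∈ Finset.range N, ∑ l ∈ Finset.range N, ‖z • singletState N‖ ^ 2 := by positivity
  linarith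

end Ground

theorem half_le_log {N : ℕ} (hN : 2 ≤ N) : 1 / 2 ≤ Real.log N := by
  have h1 : Real.log 2 ≤ Real.log N := Real.log_le_log (by norm_num) (by exact_mod_cast hN)
  have := Real.log_two_gt_d9
  norm_num at *
  linarith

/-! ### Decomposition by numbers of holes and the global gap inequality. -/

section Sectors

variable {N : ℕ} [NeZero N] (K : ℕ → ℕ → Prop) [∀ k l, Decidable (K k l)]

/-- Restriction of a state to the numbers of holes that satisfy `K`. -/
def restrict (ψ : Conf N × Conf N → ℂ) (s : Conf N × Conf N) : ℂ :=
  if K (holes s.1) (holes s.2) then ψ s else 0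

theorem HP_mulVec_restrict (ψ : Conf N × Conf N → ℂ) :
    HP N *ᵥ restrict K ψ = restrict K (HP N *ᵥ ψ) := by
  funext s
  have h : (pairProj 1 *ᵥ restrict K ψ) s
      = if K (holes s.1) (holes s.2) then (pairProj 1 *ᵥ ψ) s else 0 := by
    rw [pairProj_mulVec, pairProj_mulVec]
    by_cases h1 : s.1 1 = 2
    · rw [h1, singlet_two_left]; simp
    by_cases h2 : s.2 1 = 2
    · rw [h2, singlet_two_right]; simp
    have key : ∀ x y, singlet x y * restrict K ψ (Function.update s.1 1 x, Function.update s.2 1 y)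
        = if K (holes s.1) (holes s.2) then
          singlet x y * ψ (Function.update s.1 1 x, Function.update s.2 1 y) else 0 := by
      intro x y
      by_cases hx : x = 2
      · rw [hx, singlet_two_left]; simp
      by_cases hy : y = 2
      · rw [hy, singlet_two_right]; simp
      simp only [restrict, holes_update h1 hx, holes_update h2 hy, mul_ite, mul_zero]
    simp_rw [key]
    split_ifs <;> simp
  rw [HP_mulVec, h, restrict, restrict, HP_mulVec]
  split_ifs <;> simp

/-- Exchanges conserve the holes and the singlet involves qubit states only, so the form has no
cross terms between sectors. -/
theorem density_restrict (V₁ : ℝ) (ψ : Conf N × Conf N → ℂ) (s : Conf N × Conf N) :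
    density V₁ (restrict K ψ) s = if K (holes s.1) (holes s.2) then density V₁ ψ s else 0 := by
  unfold density ringEnergy couplingEnergy
  rw [HP_mulVec_restrict]
  simp only [restrict, holes_sw]
  split_ifs <;> simp

theorem sum_density_eq (V₁ : ℝ) (ψ : Conf N × Conf N → ℂ) :
    ∑ s, density V₁ ψ s = ∑ s, density V₁ (restrict K ψ) s
      + ∑ s, density V₁ (restrict (fun k l => ¬ K k l) ψ) s := by
  rw [← Finset.sum_add_distrib]
  refine Finset.sum_congr rfl fun s _ => ?_
  rw [density_restrict, density_restrict]
  split_ifs <;> simp_all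

theorem sum_norm_sq_eq (ψ : Conf N × Conf N → ℂ) :
    ∑ s, ‖ψ s‖ ^ 2 = ∑ s, ‖restrict K ψ s‖ ^ 2 + ∑ s, ‖restrict (fun k l => ¬ K k l) ψ s‖ ^ 2 := by
  rw [← Finset.sum_add_distrib]
  refine Finset.sum_congr rfl fun s _ => ?_
  unfold restrict
  split_ifs <;> simp_all

/-- At each configuration in the support at least one ring pays 1/N⁴, and the coupling of the rings
is a sum of squares. -/
theorem sum_density_ge_outside (hN : 2 ≤ N) {ψ : Conf N × Conf N → ℂ}
    (hψ : ∀ s, holes s.1 = 1 ∧ holes s.2 = 1 → ψ s = 0) :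
    1 / (N : ℝ) ^ 4 * ∑ s, ‖ψ s‖ ^ 2 ≤ ∑ s, density (1 / (N : ℝ) ^ 4) ψ s := by
  have hL : 1 / (N : ℝ) ^ 4 * ∑ s : Conf N × Conf N, (if holes s.1 = 1 then 0 else ‖ψ s‖ ^ 2)
      ≤ ∑ s : Conf N × Conf N, ringEnergy (1 / (N : ℝ) ^ 4) (fun c => ψ (c, s.2)) s.1 := by
    rw [Fintype.sum_prod_type_right, Fintype.sum_prod_type_right, Finset.mul_sum]
    exact Finset.sum_le_sum fun d _ => sum_ringEnergy_ge hN fun c => ψ (c, d)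
  have hR : 1 / (N : ℝ) ^ 4 * ∑ s : Conf N × Conf N, (if holes s.2 = 1 then 0 else ‖ψ s‖ ^ 2)
      ≤ ∑ s : Conf N × Conf N, ringEnergy (1 / (N : ℝ) ^ 4) (fun d => ψ (s.1, d)) s.2 := by
    rw [Fintype.sum_prod_type, Fintype.sum_prod_type, Finset.mul_sum]
    exact Finset.sum_le_sum fun c _ => sum_ringEnergy_ge hN fun d => ψ (c, d)
  have hB : 0 ≤ ∑ s, couplingEnergy ψ s := by
    refine Finset.sum_nonneg fun s _ => ?_
    unfold couplingEnergy
    positivity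
  unfold density
  rw [Finset.sum_add_distrib, Finset.sum_add_distrib]
  have hsum : ∑ s, ‖ψ s‖ ^ 2 ≤ ∑ s : Conf N × Conf N, (if holes s.1 = 1 then 0 else ‖ψ s‖ ^ 2)
      + ∑ s : Conf N × Conf N, (if holes s.2 = 1 then 0 else ‖ψ s‖ ^ 2) := by
    rw [← Finset.sum_add_distrib]
    refine Finset.sum_le_sum fun s _ => ?_
    by_cases h1 : holes s.1 = 1 <;> by_cases h2 : holes s.2 = 1
    · rw [hψ s ⟨h1, h2⟩]; simp [h1, h2]
    · simp [h1, h2]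
    · simp [h1, h2]
    · simp [h1, h2]
  have hV : (0 : ℝ) ≤ 1 / (N : ℝ) ^ 4 := by positivity
  have := mul_le_mul_of_nonneg_left hsum hV
  linarith

theorem sum_density_nonneg (hN : 2 ≤ N) (ψ : Conf N × Conf N → ℂ) :
    0 ≤ ∑ s, density (1 / (N : ℝ) ^ 4) ψ s := by
  rw [sum_density_eq (fun k l => k = 1 ∧ l = 1)]
  refine add_nonneg ?_ ?_
  · have hsec : InSector (restrict (fun k l => k = 1 ∧ l = 1) ψ) := fun s hs => if_neg hs
    rw [hsec.sum_density hN]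
    have := gridEnergy_nonneg N (field (restrict (fun k l => k = 1 ∧ l = 1) ψ))
    positivity
  · refine le_trans ?_ (sum_density_ge_outside hN fun s hs => if_neg (not_not.2 hs))
    positivity

/-- The gap inequality. -/
theorem sum_density_ge (hN : 2 ≤ N) (ψ : Conf N × Conf N → ℂ) (hψ : star (ground N) ⬝ᵥ ψ = 0) :
    1 / 4000 / ((N : ℝ) ^ 4 * Real.log N) * ∑ s, ‖ψ s‖ ^ 2
      ≤ ∑ s, density (1 / (N : ℝ) ^ 4) ψ s := by
  have hlog := half_le_log hN
  have hN0 : (0 : ℝ) < N := by exact_mod_cast NeZero.pos N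
  have hpos : 0 < (N : ℝ) ^ 4 * Real.log N := by positivity
  rw [sum_density_eq (fun k l => k = 1 ∧ l = 1), sum_norm_sq_eq (fun k l => k = 1 ∧ l = 1), mul_add]
  refine add_le_add ?_ ?_
  · have hsec : InSector (restrict (fun k l => k = 1 ∧ l = 1) ψ) := fun s hs => if_neg hs
    have horth : star (ground N) ⬝ᵥ restrict (fun k l => k = 1 ∧ l = 1) ψ = 0 := by
      rw [← hψ]
      refine Finset.sum_congr rfl fun s _ => ?_
      by_cases hs : holes s.1 = 1 ∧ holes s.2 = 1
      · rw [restrict, if_pos hs]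
      · rw [Pi.star_apply, ground_inSector s hs]; simp
    have := hsec.sum_norm_sq_le hN (1 / (N : ℝ) ^ 4) horth
    rw [div_div, one_div_mul_eq_div, div_le_iff₀ (by positivity)]
    linarith
  · refine le_trans ?_ (sum_density_ge_outside hN fun s hs => if_neg (not_not.2 hs))
    refine mul_le_mul_of_nonneg_right ?_ (by positivity)
    rw [div_div]
    apply one_div_le_one_div_of_le (by positivity)
    have : (0 : ℝ) < (N : ℝ) ^ 4 := by positivity
    nlinarith

end Sectors

/-! ### Normalization, nondegeneracy and the lower bound on the gap. -/

section Spectral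

variable {N : ℕ}

/-- The factors of the amplitudes of `singletState`. -/
def factor (j : ZMod N) (x y : Fin 3) : ℂ :=
  if j = 1 then (if x = 2 ∧ y = 2 then 1 else 0) else singlet x y

theorem star_factor (j : ZMod N) (x y : Fin 3) : star (factor j x y) = factor j x y := by
  unfold factor
  split_ifs
  · simp
  · simp
  · exact star_singlet x y

theorem sum_factor_mul (j : ZMod N) (a b : Fin 3) : ∑ y, factor j a y * factor j b y
    = if j = 1 then (if a = 2 ∧ b = 2 then 1 else 0) else if a = b ∧ a ≠ 2 then 1 / 2 else 0 := by
  by_cases h : j = 1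
  · simp only [factor, if_pos h]
    by_cases ha : a = 2 <;> by_cases hb : b = 2 <;> simp [ha, hb]
  · simp only [factor, if_neg h]
    exact sum_singlet_mul_singlet a b

variable [NeZero N]

open scoped ComplexOrder

theorem hamiltonian_posSemidef (hN : 2 ≤ N) : (hamiltonian N (1 / (N : ℝ) ^ 4) 1).PosSemidef := by
  refine PosSemidef.of_dotProduct_mulVec_nonneg (hamiltonian_isHermitian _) fun ψ => ?_
  rw [form_eq]
  exact_mod_cast sum_density_nonneg hN ψ

theorem hamiltonian_mulVec_ground (hN : 2 ≤ N) :
    hamiltonian N (1 / (N : ℝ) ^ 4) 1 *ᵥ ground N = 0 := by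
  rw [← (hamiltonian_posSemidef hN).dotProduct_mulVec_zero_iff, form_eq, sum_density_ground hN]
  simp

theorem singletState_eq_prod (s : Conf N × Conf N) :
    singletState N s = ∏ j, factor j (s.1 j) (s.2 j) := by
  rw [singletState_apply, ← Finset.mul_prod_erase Finset.univ _ (Finset.mem_univ 1)]
  have h : ∏ j ∈ Finset.univ.erase (1 : ZMod N), factor j (s.1 j) (s.2 j)
      = ∏ j ∈ Finset.univ.erase (1 : ZMod N), singlet (s.1 j) (s.2 j) := by
    refine Finset.prod_congr rfl fun j hj => ?_
    rw [factor, if_neg (Finset.ne_of_mem_erase hj)]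
  rw [h, factor, if_pos rfl, ite_mul, one_mul, zero_mul]

theorem star_singletState (s : Conf N × Conf N) : star (singletState N s) = singletState N s := by
  rw [singletState_eq_prod, star_prod]
  simp only [star_factor]

theorem star_ground (s : Conf N × Conf N) : star (ground N s) = ground N s := by
  simp only [ground, star_sum, star_singletState]

/-- `singletState` as a matrix. -/
def singletMatrix (N : ℕ) [NeZero N] : RingOp N := Matrix.of fun a b => singletState N (a, b)

/-- The amplitudes are products over the sites, so the matrix product factorizes into one 3 × 3
product per site. -/
theorem singletMatrix_mul_transpose_apply (a b : Conf N) :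
    (singletMatrix N * (singletMatrix N)ᵀ) a b = ∏ j, if j = 1 then
      (if a j = 2 ∧ b j = 2 then 1 else 0) else if a j = b j ∧ a j ≠ 2 then 1 / 2 else 0 := by
  simp_rw [mul_apply, transpose_apply, singletMatrix, of_apply, singletState_eq_prod,
    ← Finset.prod_mul_distrib, ← sum_factor_mul]
  rw [Finset.prod_univ_sum, Fintype.piFinset_univ]

theorem norm_singletState_sq : ‖singletState N‖ ^ 2 = 1 := by
  have h : ∑ a : Conf N, (singletMatrix N * (singletMatrix N)ᵀ) a a = 1 := by
    simp_rw [singletMatrix_mul_transpose_apply]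
    simp only [true_and]
    have e := Finset.prod_univ_sum (fun _ : ZMod N => (Finset.univ : Finset (Fin 3)))
      (fun j x => (if j = 1 then (if x = 2 ∧ x = 2 then (1 : ℂ) else 0)
        else if x ≠ 2 then 1 / 2 else 0))
    rw [Fintype.piFinset_univ] at e
    rw [← e]
    refine Finset.prod_eq_one fun j _ => ?_
    split_ifs <;> simp [Fin.sum_univ_three]
    norm_num
  have h2 : ((‖singletState N‖ ^ 2 : ℝ) : ℂ) = 1 := by
    rw [← h, EuclideanSpace.norm_sq_eq, Fintype.sum_prod_type]
    push_cast
    refine Finset.sum_congr rfl fun a _ => ?_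
    rw [mul_apply]
    refine Finset.sum_congr rfl fun b _ => ?_
    rw [transpose_apply, singletMatrix, of_apply, ← Complex.conj_mul', starRingEnd_apply,
      star_singletState]
  exact_mod_cast h2

theorem sum_norm_ground_sq : ∑ s, ‖ground N s‖ ^ 2 = (N : ℝ) ^ 2 := by
  rw [ground_inSector.sum_norm_sq]
  have : ∀ k ∈ Finset.range N, ∀ l ∈ Finset.range N, ‖field (ground N) k l‖ ^ 2 = 1 := by
    intro k hk l hl
    rw [field_ground (Finset.mem_range.1 hk) (Finset.mem_range.1 hl), norm_singletState_sq]
  rw [Finset.sum_congr rfl fun k hk => Finset.sum_congr rfl fun l hl => this k hk l hl]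
  simp
  ring

/-- The component orthogonal to `ground` is again in the kernel, hence has zero form, and the gap
inequality makes it vanish. The division by N² is the squared norm of `ground`. -/
theorem eq_smul_ground (hN : 2 ≤ N) {ψ : Conf N × Conf N → ℂ}
    (hψ : hamiltonian N (1 / (N : ℝ) ^ 4) 1 *ᵥ ψ = 0) : ∃ z : ℂ, ψ = z • ground N := by
  have hN0 : (N : ℂ) ≠ 0 := by exact_mod_cast NeZero.ne N
  set z : ℂ := star (ground N) ⬝ᵥ ψ / (N : ℂ) ^ 2
  refine ⟨z, ?_⟩
  set χ := ψ - z • ground N with hχ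
  have h1 : star (ground N) ⬝ᵥ χ = 0 := by
    rw [hχ, dotProduct_sub, dotProduct_smul, star_dotProduct_self, sum_norm_ground_sq]
    simp only [z, smul_eq_mul]
    push_cast
    field_simp
    ring
  have h2 : hamiltonian N (1 / (N : ℝ) ^ 4) 1 *ᵥ χ = 0 := by
    rw [hχ, mulVec_sub, mulVec_smul, hψ, hamiltonian_mulVec_ground hN]
    simp
  have h3 := form_eq (1 / (N : ℝ) ^ 4) χ
  rw [h2, dotProduct_zero] at h3
  have h4 : ∑ s, density (1 / (N : ℝ) ^ 4) χ s = 0 := by exact_mod_cast h3.symm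
  have h5 := sum_density_ge hN χ h1
  rw [h4] at h5
  have hlog := half_le_log hN
  have hNp : (0 : ℝ) < N := by exact_mod_cast NeZero.pos N
  have hc : 0 < 1 / 4000 / ((N : ℝ) ^ 4 * Real.log N) := by positivity
  have h6 : ∑ s, ‖χ s‖ ^ 2 = 0 := by
    refine le_antisymm ?_ (by positivity)
    by_contra! h
    have := mul_pos hc h
    linarith
  rw [Finset.sum_eq_zero_iff_of_nonneg fun _ _ => by positivity] at h6
  have h7 : χ = 0 := by
    funext s
    have := h6 s (Finset.mem_univ s)
    simpa using this
  exact sub_eq_zero.1 h7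

theorem mem_energySpace {ι : Type*} [Fintype ι] [DecidableEq ι] {H : Matrix ι ι ℂ} {E : ℝ}
    {v : ι → ℂ} : v ∈ energySpace H E ↔ H *ᵥ v = (E : ℂ) • v := by
  rw [energySpace, Module.End.mem_eigenspace_iff, toLin'_apply]

theorem mem_energies {ι : Type*} [Fintype ι] [DecidableEq ι] {H : Matrix ι ι ℂ} {E : ℝ} :
    E ∈ energies H ↔ ∃ v ≠ 0, H *ᵥ v = (E : ℂ) • v := by
  constructor
  · intro h
    obtain ⟨v, hv⟩ := Module.End.HasEigenvalue.exists_hasEigenvector h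
    exact ⟨v, hv.2, by simpa using hv.apply_eq_smul⟩
  · rintro ⟨v, hv, h⟩
    exact Module.End.hasEigenvalue_of_hasEigenvector
      ⟨Module.End.mem_eigenspace_iff.2 (by rw [toLin'_apply, h]), hv⟩

theorem ground_ne_zero : ground N ≠ 0 := by
  intro h
  have h1 := sum_norm_ground_sq (N := N)
  rw [h] at h1
  simp only [Pi.zero_apply, norm_zero, ne_eq, OfNat.ofNat_ne_zero, not_false_eq_true, zero_pow,
    Finset.sum_const_zero] at h1
  have := NeZero.pos N
  have : 0 < (N : ℝ) ^ 2 := by positivity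
  exact this.ne h1

/-- A nonzero level has its eigenvectors orthogonal to the zero mode, so the gap inequality applies
to them. -/
theorem energy_ge (hN : 2 ≤ N) {E : ℝ} (hE : E ∈ energies (hamiltonian N (1 / (N : ℝ) ^ 4) 1))
    (h0 : E ≠ 0) : 1 / 4000 / ((N : ℝ) ^ 4 * Real.log N) ≤ E := by
  obtain ⟨v, hv, hHv⟩ := mem_energies.1 hE
  have horth : star (ground N) ⬝ᵥ v = 0 := by
    have h1 : star (ground N) ⬝ᵥ (hamiltonian N (1 / (N : ℝ) ^ 4) 1 *ᵥ v) = 0 := by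
      rw [dotProduct_mulVec, ← (hamiltonian_isHermitian _).eq, ← star_mulVec,
        hamiltonian_mulVec_ground hN, star_zero, zero_dotProduct]
    rw [hHv, dotProduct_smul, smul_eq_mul, mul_eq_zero] at h1
    exact h1.resolve_left (by exact_mod_cast h0)
  have h1 := form_eq (1 / (N : ℝ) ^ 4) v
  rw [hHv, dotProduct_smul, star_dotProduct_self, smul_eq_mul] at h1
  have h2 : E * ∑ s, ‖v s‖ ^ 2 = ∑ s, density (1 / (N : ℝ) ^ 4) v s := by exact_mod_cast h1
  have h3 := sum_density_ge hN v horth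
  rw [← h2] at h3
  refine le_of_mul_le_mul_right h3 ?_
  obtain ⟨s, hs⟩ := Function.ne_iff.1 hv
  exact Finset.sum_pos' (fun _ _ => by positivity) ⟨s, Finset.mem_univ s, by
    have : 0 < ‖v s‖ := norm_pos_iff.2 hs
    positivity⟩

theorem isNondegenerateGroundEnergy_zero (hN : 2 ≤ N) :
    IsNondegenerateGroundEnergy (hamiltonian N (1 / (N : ℝ) ^ 4) 1) 0 := by
  have hlog := half_le_log hN
  refine ⟨⟨mem_energies.2 ⟨ground N, ground_ne_zero, ?_⟩, fun E hE => ?_⟩, ?_⟩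
  · rw [hamiltonian_mulVec_ground hN]; simp
  · by_cases h0 : E = 0
    · exact h0.ge
    · exact le_trans (by positivity) (energy_ge hN hE h0)
  · have hmem : ground N ∈ energySpace (hamiltonian N (1 / (N : ℝ) ^ 4) 1) 0 := by
      rw [mem_energySpace, hamiltonian_mulVec_ground hN]; simp
    rw [finrank_eq_one_iff_of_nonzero' (⟨ground N, hmem⟩ : energySpace _ _)]
    · rintro ⟨w, hw⟩
      rw [mem_energySpace] at hw
      obtain ⟨z, hz⟩ := eq_smul_ground hN (by simpa using hw)
      exact ⟨z, Subtype.ext hz.symm⟩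
    · intro h
      exact ground_ne_zero (congrArg Subtype.val h)

end Spectral

/-! ### An explicit excited level and the upper bound on the gap. -/

section Excited

variable {N : ℕ} [NeZero N]

/-- A state without holes, with a singlet of the sites `1`. -/
def noHoleState (s : Conf N × Conf N) : ℂ :=
  if ∀ j ≠ (1 : ZMod N), s.1 j = 0 ∧ s.2 j = 0 then singlet (s.1 1) (s.2 1) else 0

theorem noHoleState_eq_zero {s : Conf N × Conf N} {j : ZMod N} (h : s.1 j = 2 ∨ s.2 j = 2) :
    noHoleState s = 0 := by
  rw [noHoleState, ite_eq_right_iff]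
  intro h0
  by_cases hj : j = 1
  · subst hj
    rcases h with h | h <;> simp [h, singlet_two_left, singlet_two_right]
  · rcases h with h | h
    · rw [(h0 j hj).1] at h; exact absurd h (by decide)
    · rw [(h0 j hj).2] at h; exact absurd h (by decide)

theorem pairProj_noHoleState : pairProj (1 : ZMod N) *ᵥ noHoleState = noHoleState := by
  funext s
  rw [pairProj_mulVec]
  have : ∀ x y, noHoleState (Function.update s.1 1 x, Function.update s.2 1 y)
      = singlet x y * if ∀ j ≠ (1 : ZMod N), s.1 j = 0 ∧ s.2 j = 0 then 1 else 0 := by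
    intro x y
    rw [noHoleState, mul_ite, mul_one, mul_zero]
    refine if_congr (forall₂_congr fun j hj => ?_) (by simp) rfl
    simp only [Function.update_of_ne hj]
  simp_rw [this, ← mul_assoc, ← Finset.sum_mul]
  rw [sum_singlet_sq, one_mul, noHoleState, mul_ite, mul_one, mul_zero]

/-- Without holes nothing hops, the singlet is annihilated by `HP`, and each ring contributes V₁.
This level shows that the gap exists and is at most 2/N⁴. -/
theorem hamiltonian_mulVec_noHoleState (V₁ : ℝ) :
    hamiltonian N V₁ 1 *ᵥ noHoleState = ((2 * V₁ : ℝ) : ℂ) • noHoleState := by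
  funext s
  rw [hamiltonian_mulVec, ringHopping_mulVec, ringHopping_mulVec, HB_mulVec, HP_mulVec,
    pairProj_noHoleState, ringPotential_mulVec, ringPotential_mulVec]
  have hpot : (selfEnergy V₁ s.1 : ℂ) * noHoleState s = V₁ * noHoleState s
      ∧ (selfEnergy V₁ s.2 : ℂ) * noHoleState s = V₁ * noHoleState s := by
    by_cases h : noHoleState s = 0
    · simp [h]
    · have h1 : ∀ j, s.1 j ≠ 2 := fun j hj => h (noHoleState_eq_zero (Or.inl hj))
      have h2 : ∀ j, s.2 j ≠ 2 := fun j hj => h (noHoleState_eq_zero (Or.inr hj))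
      simp [selfEnergy, holes, adjHoles, h1, h2]
  have hD : (if s.1 1 ≠ 2 ∧ s.2 1 ≠ 2 then noHoleState s else 0) = noHoleState s := by
    rw [ite_eq_left_iff, not_and_or, not_ne_iff, not_ne_iff]
    exact fun h => (noHoleState_eq_zero h).symm
  have hz : ∀ (i j : ZMod N) (c d : Conf N), c i = 2 ∨ d j = 2 → noHoleState (c, d) = 0 :=
    fun i j c d h => h.elim (fun h => noHoleState_eq_zero (j := i) (Or.inl h))
      fun h => noHoleState_eq_zero (j := j) (Or.inr h)
  have hL : ∀ i : ZMod N, (if s.1 i = 2 then noHoleState (s.1, s.2) - noHoleState (sw i s.1, s.2) else 0)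
      + (if sw i s.1 i = 2 then noHoleState (s.1, s.2) - noHoleState (sw i s.1, s.2) else 0) = 0 := by
    intro i
    have h1 : s.1 i = 2 → noHoleState (s.1, s.2) - noHoleState (sw i s.1, s.2) = 0 := fun h => by
      rw [hz i 0 _ _ (Or.inl h), hz (i + 1) 0 _ _ (Or.inl (by rw [sw_right, h])), sub_zero]
    have h2 : sw i s.1 i = 2 → noHoleState (s.1, s.2) - noHoleState (sw i s.1, s.2) = 0 := fun h => by
      rw [hz i 0 (sw i s.1) _ (Or.inl h), hz (i + 1) 0 s.1 _ (Or.inl (by rwa [sw_left] at h)),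
        sub_zero]
    rw [ite_eq_right_iff.2 h1, ite_eq_right_iff.2 h2, add_zero]
  have hR : ∀ i : ZMod N, (if s.2 i = 2 then noHoleState (s.1, s.2) - noHoleState (s.1, sw i s.2) else 0)
      + (if sw i s.2 i = 2 then noHoleState (s.1, s.2) - noHoleState (s.1, sw i s.2) else 0) = 0 := by
    intro i
    have h1 : s.2 i = 2 → noHoleState (s.1, s.2) - noHoleState (s.1, sw i s.2) = 0 := fun h => by
      rw [hz 0 i _ _ (Or.inr h), hz 0 (i + 1) _ _ (Or.inr (by rw [sw_right, h])), sub_zero]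
    have h2 : sw i s.2 i = 2 → noHoleState (s.1, s.2) - noHoleState (s.1, sw i s.2) = 0 := fun h => by
      rw [hz 0 i _ (sw i s.2) (Or.inr h), hz 0 (i + 1) _ s.2 (Or.inr (by rwa [sw_left] at h)),
        sub_zero]
    rw [ite_eq_right_iff.2 h1, ite_eq_right_iff.2 h2, add_zero]
  have hB1 : s.1 0 = 2 ∧ s.2 0 = 2 → noHoleState s - noHoleState (sw 0 s.1, sw 0 s.2) = 0 :=
    fun h => by
      rw [noHoleState_eq_zero (Or.inl h.1), hz (0 + 1) 0 _ _ (Or.inl (by rw [sw_right, h.1])),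
        sub_zero]
  have hB2 : sw 0 s.1 0 = 2 ∧ sw 0 s.2 0 = 2 →
      noHoleState s - noHoleState (sw 0 s.1, sw 0 s.2) = 0 :=
    fun h => by
      rw [hz 0 0 (sw 0 s.1) _ (Or.inl h.1),
        noHoleState_eq_zero (j := 0 + 1) (Or.inl (by have := h.1; rwa [sw_left] at this)), sub_zero]
  rw [hD, ite_eq_right_iff.2 hB1, ite_eq_right_iff.2 hB2, Finset.sum_eq_zero fun i _ => hL i,
    Finset.sum_eq_zero fun i _ => hR i, Prod.mk.eta, hpot.1, hpot.2, Pi.smul_apply, smul_eq_mul]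
  push_cast
  ring

theorem noHoleState_ne_zero : (noHoleState : Conf N × Conf N → ℂ) ≠ 0 := by
  intro h
  have h1 := congrFun h (fun _ => 0, Function.update (fun _ => 0) 1 1)
  rw [noHoleState, if_pos] at h1
  · simp [singlet] at h1
  · intro j hj
    simp [hj]

theorem two_mul_mem_energies (V₁ : ℝ) : 2 * V₁ ∈ energies (hamiltonian N V₁ 1) :=
  mem_energies.2 ⟨noHoleState, noHoleState_ne_zero, hamiltonian_mulVec_noHoleState V₁⟩

theorem exists_isGapAbove_zero (hN : 2 ≤ N) :
    ∃ Δ, IsGapAbove (hamiltonian N (1 / (N : ℝ) ^ 4) 1) 0 Δ ∧ Δ ≤ 2 / (N : ℝ) ^ 4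
      ∧ 1 / 4000 / ((N : ℝ) ^ 4 * Real.log N) ≤ Δ := by
  have hNp : (0 : ℝ) < N := by exact_mod_cast NeZero.pos N
  set S : Set ℝ := {E | E ∈ energies (hamiltonian N (1 / (N : ℝ) ^ 4) 1) ∧ 0 < E}
  have hfin : S.Finite := by
    have h := Module.End.finite_hasEigenvalue (toLin' (hamiltonian N (1 / (N : ℝ) ^ 4) 1))
    exact (h.preimage Complex.ofReal_injective.injOn).subset fun E hE => hE.1
  have hmem : 2 * (1 / (N : ℝ) ^ 4) ∈ S := ⟨two_mul_mem_energies _, by positivity⟩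
  obtain ⟨Δ, hΔ, hmin⟩ := Set.exists_min_image S id hfin ⟨_, hmem⟩
  refine ⟨Δ, ?_, ?_, energy_ge hN hΔ.1 hΔ.2.ne'⟩
  · rw [IsGapAbove, zero_add]
    exact ⟨hΔ, fun E hE => hmin E hE⟩
  · have := hmin _ hmem
    simp only [id] at this
    rw [mul_one_div] at this
    exact this

end Excited

/-! ### Flat entanglement spectrum and the entropy. -/

section Entropy

/-- An eigenvalue μ satisfies μ² = 2⁻ⁿ μ; a nonzero one contributes n μ to the entropy, and the
trace is 1. The eigenvalue 0 is harmless because of the factor μ. -/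
theorem entropy_of_flat {ι : Type*} [Fintype ι] [DecidableEq ι] {ρ : Matrix ι ι ℂ}
    (hρ : ρ.IsHermitian) (n : ℕ) (htr : ρ.trace = 1) (hsq : ρ * ρ = ((1 / 2 : ℂ) ^ n) • ρ) :
    entropy ρ hρ = n := by
  have hev : ∀ i, hρ.eigenvalues i = 0 ∨ hρ.eigenvalues i = (1 / 2 : ℝ) ^ n := by
    intro i
    set v := (hρ.eigenvectorBasis i).ofLp
    set μ := hρ.eigenvalues i
    have h1 : ρ *ᵥ v = μ • v := hρ.mulVec_eigenvectorBasis i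
    have hv : v ≠ 0 := by
      intro h
      have := hρ.eigenvectorBasis.orthonormal.ne_zero i
      exact this (WithLp.ofLp_injective 2 h)
    have h2 : (ρ * ρ) *ᵥ v = (μ * μ) • v := by
      rw [← mulVec_mulVec, h1, mulVec_smul, h1, smul_smul]
    rw [hsq, smul_mulVec, h1] at h2
    obtain ⟨s, hs⟩ := Function.ne_iff.1 hv
    have h3 := congrFun h2 s
    simp only [Pi.smul_apply, Complex.real_smul, smul_eq_mul, ← mul_assoc] at h3
    have h4 := mul_right_cancel₀ hs h3
    have h5 : (1 / 2 : ℝ) ^ n * μ = μ * μ := by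
      apply Complex.ofReal_injective
      push_cast at h4 ⊢
      exact h4
    have h6 : μ * (μ - (1 / 2) ^ n) = 0 := by linarith
    rcases mul_eq_zero.1 h6 with h | h
    · exact Or.inl h
    · exact Or.inr (sub_eq_zero.1 h)
  have hsum : ∑ i, hρ.eigenvalues i = 1 := by
    have := hρ.trace_eq_sum_eigenvalues
    rw [htr] at this
    apply Complex.ofReal_injective
    push_cast
    exact this.symm
  have hterm : ∀ i, hρ.eigenvalues i * Real.logb 2 (hρ.eigenvalues i)
      = -(n : ℝ) * hρ.eigenvalues i := by
    intro i
    rcases hev i with h | h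
    · rw [h]; simp
    · have : Real.logb 2 ((1 / 2 : ℝ) ^ n) = -n := by
        rw [Real.logb_pow, one_div, Real.logb_inv, Real.logb_self_eq_one (by norm_num)]
        ring
      rw [h, this]
      ring
  unfold entropy
  simp_rw [hterm]
  rw [← Finset.mul_sum, hsum]
  ring

variable {N : ℕ} [NeZero N]

/-- Sum over the transports of a hole, as a matrix. -/
def carrySum (N : ℕ) [NeZero N] : RingOp N :=
  Matrix.of fun c a => ∑ k ∈ Finset.range N, if a = c ∘ (carry N k).symm then 1 else 0

/-- The ground state as a matrix. -/
def groundMatrix (N : ℕ) [NeZero N] : RingOp N := Matrix.of fun c d => ground N (c, d)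

theorem singletMatrix_mul_carrySum_transpose_apply (a e : Conf N) :
    (singletMatrix N * (carrySum N)ᵀ) a e
      = ∑ l ∈ Finset.range N, singletState N (a, e ∘ (carry N l).symm) := by
  simp only [mul_apply, transpose_apply, carrySum, of_apply, Finset.mul_sum]
  rw [Finset.sum_comm]
  simp [singletMatrix]

theorem groundMatrix_eq : groundMatrix N = carrySum N * (singletMatrix N * (carrySum N)ᵀ) := by
  ext c d
  rw [mul_apply]
  simp_rw [singletMatrix_mul_carrySum_transpose_apply]
  simp only [carrySum, of_apply, Finset.sum_mul]
  rw [Finset.sum_comm]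
  simp [groundMatrix, ground]

/-- One sign for each of the N - 1 antisymmetric singlets. -/
theorem singletMatrix_transpose : ∃ ε : ℂ, ε * ε = 1 ∧ (singletMatrix N)ᵀ = ε • singletMatrix N := by
  refine ⟨∏ _j ∈ Finset.univ.erase (1 : ZMod N), -1, ?_, ?_⟩
  · rw [← Finset.prod_mul_distrib]; simp
  · ext a b
    rw [transpose_apply, Matrix.smul_apply, singletMatrix, of_apply, of_apply, singletState_apply,
      singletState_apply, smul_eq_mul, mul_ite, mul_zero, ← Finset.prod_mul_distrib]
    refine if_congr and_comm (Finset.prod_congr rfl fun j _ => ?_) rfl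
    rw [singlet_swap, neg_one_mul]

theorem singletState_mul_eq_zero {a a' e : Conf N} {l l' : ℕ} (hl : l < N) (hl' : l' < N)
    (hne : l ≠ l') : singletState N (a, e ∘ (carry N l).symm)
      * singletState N (a', e ∘ (carry N l').symm) = 0 := by
  by_contra h
  have h1 := left_ne_zero_of_mul h
  have h2 := right_ne_zero_of_mul h
  have hh : holes e = 1 := by
    by_contra hh
    exact h1 (singletState_inSector _ fun h => hh (by simpa only [holes_comp] using h.2))
  have key : ∀ {a : Conf N} {l : ℕ}, l < N → singletState N (a, e ∘ (carry N l).symm) ≠ 0 →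
      e (site N l) = 2 := by
    intro a l hl h
    rw [singletState_apply] at h
    by_contra h2
    refine h (if_neg fun h3 => h2 ?_)
    have : (e ∘ (carry N l).symm) 1 = 2 := h3.2
    rwa [Function.comp_apply, carry_symm_one hl] at this
  exact hne ((site_inj hl hl').1 (eq_of_holes_eq_one hh (key hl h1) (key hl' h2)))

/-- Terms with different hole positions are orthogonal and the N equal positions give N copies of
the same product: tracing out the right ring does not see where its hole is. -/
theorem singlet_carry_mul_transpose :
    (singletMatrix N * (carrySum N)ᵀ) * (singletMatrix N * (carrySum N)ᵀ)ᵀ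
      = (N : ℂ) • (singletMatrix N * (singletMatrix N)ᵀ) := by
  ext a a'
  rw [mul_apply]
  simp only [transpose_apply (singletMatrix N * (carrySum N)ᵀ),
    singletMatrix_mul_carrySum_transpose_apply, Finset.sum_mul_sum]
  have h1 : ∀ e : Conf N, ∑ l ∈ Finset.range N, ∑ l' ∈ Finset.range N,
      singletState N (a, e ∘ (carry N l).symm) * singletState N (a', e ∘ (carry N l').symm)
      = ∑ l ∈ Finset.range N,
        singletState N (a, e ∘ (carry N l).symm) * singletState N (a', e ∘ (carry N l).symm) := by
    intro e
    refine Finset.sum_congr rfl fun l hl => ?_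
    refine Finset.sum_eq_single_of_mem l hl fun l' hl' hne => ?_
    exact singletState_mul_eq_zero (Finset.mem_range.1 hl) (Finset.mem_range.1 hl') hne.symm
  simp_rw [h1]
  rw [Finset.sum_comm, Matrix.smul_apply, mul_apply, smul_eq_mul]
  have h2 : ∀ l, ∑ e : Conf N,
      singletState N (a, e ∘ (carry N l).symm) * singletState N (a', e ∘ (carry N l).symm)
      = ∑ b, singletMatrix N a b * (singletMatrix N)ᵀ b a' := by
    intro l
    refine Finset.sum_nbij' (fun e => e ∘ (carry N l).symm) (fun b => b ∘ carry N l)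
      (by simp) (by simp) ?_ ?_ (fun _ _ => rfl)
    · intro e _; funext j; simp
    · intro e _; exact comp_carry_comp_symm e l
  simp_rw [h2]
  simp

/-- M Mᵀ is 2^-(N-1) times the projector onto the configurations whose only hole is at site 1, and
the rows of M vanish outside them. -/
theorem singletMatrix_mul_transpose_mul :
    singletMatrix N * (singletMatrix N)ᵀ * singletMatrix N
      = ((1 / 2 : ℂ) ^ (N - 1)) • singletMatrix N := by
  ext a b
  have h : ∀ c, (singletMatrix N * (singletMatrix N)ᵀ) a c * singletMatrix N c b
      = if c = a then (1 / 2 : ℂ) ^ (N - 1) * singletMatrix N a b else 0 := by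
    intro c
    rw [singletMatrix_mul_transpose_apply]
    split_ifs with hc
    · subst hc
      by_cases h0 : singletMatrix N c b = 0
      · rw [h0]; simp
      congr 1
      have h0' : singletState N (c, b) ≠ 0 := h0
      rw [singletState_apply] at h0'
      have h1 : c 1 = 2 ∧ b 1 = 2 := by
        by_contra hcon
        exact h0' (if_neg hcon)
      rw [if_pos h1, Finset.prod_ne_zero_iff] at h0'
      rw [← Finset.mul_prod_erase Finset.univ _ (Finset.mem_univ (1 : ZMod N)), if_pos rfl,
        if_pos ⟨h1.1, h1.1⟩, one_mul]
      have h2 : ∀ j ∈ Finset.univ.erase (1 : ZMod N), (if j = 1 then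
          (if c j = 2 ∧ c j = 2 then (1 : ℂ) else 0) else if c j = c j ∧ c j ≠ 2 then 1 / 2 else 0)
          = 1 / 2 := by
        intro j hj
        rw [if_neg (Finset.ne_of_mem_erase hj), if_pos]
        refine ⟨rfl, fun h => h0' j hj ?_⟩
        simp only [h, singlet_two_left]
      rw [Finset.prod_congr rfl h2, Finset.prod_const, Finset.card_erase_of_mem (Finset.mem_univ _),
        Finset.card_univ, ZMod.card]
    · obtain ⟨j, hj⟩ := Function.ne_iff.1 hc
      refine mul_eq_zero_of_left (Finset.prod_eq_zero (Finset.mem_univ j) ?_) _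
      by_cases h1 : j = 1
      · rw [if_pos h1, if_neg]
        rintro ⟨h2, h3⟩
        exact hj (h3.trans h2.symm)
      · rw [if_neg h1, if_neg]
        rintro ⟨h2, -⟩
        exact hj h2.symm
  rw [mul_apply, Finset.sum_congr rfl fun c _ => h c]
  simp

theorem groundMatrix_mul_transpose_mul :
    groundMatrix N * (groundMatrix N)ᵀ * groundMatrix N
      = ((N : ℂ) ^ 2 * (1 / 2 : ℂ) ^ (N - 1)) • groundMatrix N := by
  obtain ⟨ε, hε, hT⟩ := singletMatrix_transpose (N := N)
  set B := carrySum N with hB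
  set M := singletMatrix N with hM
  have h1 : (M * Bᵀ) * (M * Bᵀ)ᵀ = (N : ℂ) • (M * Mᵀ) := singlet_carry_mul_transpose
  have h1' : M * Bᵀ * B * Mᵀ = (N : ℂ) • (M * Mᵀ) := by
    rw [← h1, transpose_mul, transpose_transpose]
    simp only [Matrix.mul_assoc]
  -- M and Mᵀ differ by a sign that occurs twice on each side, so the collapse of Bᵀ B also holds
  -- with the transposes exchanged.
  have h2 : Mᵀ * Bᵀ * B * M = (N : ℂ) • (Mᵀ * M) := by
    have : M * Bᵀ * B * Mᵀ = Mᵀ * Bᵀ * B * M := by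
      rw [hT]
      simp only [Matrix.smul_mul, Matrix.mul_smul]
    rw [← this, h1', hT]
    simp only [Matrix.smul_mul, Matrix.mul_smul]
  have h3 : M * Mᵀ * M = ((1 / 2 : ℂ) ^ (N - 1)) • M := singletMatrix_mul_transpose_mul
  have hG : groundMatrix N = B * (M * Bᵀ) := groundMatrix_eq
  calc groundMatrix N * (groundMatrix N)ᵀ * groundMatrix N
      = B * (M * Bᵀ * B * Mᵀ) * Bᵀ * B * M * Bᵀ := by
        rw [hG]
        simp only [transpose_mul, transpose_transpose, Matrix.mul_assoc]
    _ = (N : ℂ) • (B * M * (Mᵀ * Bᵀ * B * M) * Bᵀ) := by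
        rw [h1']
        simp only [Matrix.smul_mul, Matrix.mul_smul, Matrix.mul_assoc]
    _ = (N : ℂ) • (N : ℂ) • (B * (M * Mᵀ * M) * Bᵀ) := by
        rw [h2]
        simp only [Matrix.smul_mul, Matrix.mul_smul, Matrix.mul_assoc]
    _ = _ := by
        rw [h3, hG]
        simp only [Matrix.smul_mul, Matrix.mul_smul, Matrix.mul_assoc, smul_smul]
        congr 1
        ring

theorem reducedLeft_smul_ground (z : ℂ) :
    reducedLeft (z • ground N) = ((‖z‖ ^ 2 : ℝ) : ℂ) • (groundMatrix N * (groundMatrix N)ᵀ) := by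
  ext c d
  rw [Matrix.smul_apply, mul_apply, smul_eq_mul, Finset.mul_sum, reducedLeft, of_apply]
  refine Finset.sum_congr rfl fun e _ => ?_
  rw [transpose_apply, groundMatrix, of_apply, of_apply, Pi.smul_apply, Pi.smul_apply, star_smul,
    star_ground, smul_eq_mul, smul_eq_mul]
  push_cast
  rw [← Complex.conj_mul', starRingEnd_apply]
  ring

theorem ground_swap : ∃ ε : ℂ, ε * ε = 1 ∧ (groundMatrix N)ᵀ = ε • groundMatrix N := by
  obtain ⟨ε, hε, hT⟩ := singletMatrix_transpose (N := N)
  refine ⟨ε, hε, ?_⟩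
  rw [groundMatrix_eq, transpose_mul, transpose_mul, transpose_transpose, hT]
  simp only [Matrix.smul_mul, Matrix.mul_smul, Matrix.mul_assoc]

theorem reducedRight_smul_ground (z : ℂ) :
    reducedRight (z • ground N) = reducedLeft (z • ground N) := by
  obtain ⟨ε, hε, hT⟩ := ground_swap (N := N)
  have hR : reducedRight (z • ground N)
      = ((‖z‖ ^ 2 : ℝ) : ℂ) • ((groundMatrix N)ᵀ * groundMatrix N) := by
    ext c d
    rw [Matrix.smul_apply, mul_apply, smul_eq_mul, Finset.mul_sum, reducedRight, of_apply]
    refine Finset.sum_congr rfl fun e _ => ?_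
    rw [transpose_apply, groundMatrix, of_apply, of_apply, Pi.smul_apply, Pi.smul_apply, star_smul,
      star_ground, smul_eq_mul, smul_eq_mul]
    push_cast
    rw [← Complex.conj_mul', starRingEnd_apply]
    ring
  rw [hR, reducedLeft_smul_ground, hT, Matrix.smul_mul, Matrix.mul_smul]

theorem entropyLeft_smul_ground {z : ℂ} (hz : ∑ s, ‖(z • ground N) s‖ ^ 2 = 1) :
    entropyLeft (z • ground N) = (N : ℝ) - 1 := by
  have hN := NeZero.pos N
  have hcast : ((N - 1 : ℕ) : ℝ) = (N : ℝ) - 1 := by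
    rw [Nat.cast_sub hN]; simp
  rw [← hcast]
  have hnorm : ‖z‖ ^ 2 * (N : ℝ) ^ 2 = 1 := by
    rw [← hz, ← sum_norm_ground_sq, Finset.mul_sum]
    refine Finset.sum_congr rfl fun s _ => ?_
    rw [Pi.smul_apply, norm_smul, mul_pow]
  refine entropy_of_flat _ (N - 1) ?_ ?_
  · have : (reducedLeft (z • ground N)).trace = ((∑ s, ‖(z • ground N) s‖ ^ 2 : ℝ) : ℂ) := by
      rw [trace, Fintype.sum_prod_type]
      push_cast
      refine Finset.sum_congr rfl fun c _ => ?_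
      rw [diag_apply, reducedLeft, of_apply]
      refine Finset.sum_congr rfl fun e _ => ?_
      rw [← Complex.mul_conj', starRingEnd_apply]
    rw [this, hz, Complex.ofReal_one]
  · have hc : ((‖z‖ ^ 2 : ℝ) : ℂ) * (N : ℂ) ^ 2 = 1 := by
      exact_mod_cast congrArg Complex.ofReal hnorm
    rw [reducedLeft_smul_ground, Matrix.smul_mul, Matrix.mul_smul, ← Matrix.mul_assoc,
      groundMatrix_mul_transpose_mul, Matrix.smul_mul, smul_smul, smul_smul, smul_smul]
    congr 1
    -- The factor N² of G Gᵀ G cancels against the normalization |z|² N² = 1, leaving the flat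
    -- eigenvalue 2^-(N-1).
    linear_combination ((‖z‖ ^ 2 : ℝ) : ℂ) * (1 / 2) ^ (N - 1) * hc

theorem entropyRight_smul_ground (z : ℂ) :
    entropyLeft (z • ground N) = entropyRight (z • ground N) := by
  have : ∀ (ρ ρ' : RingOp N) (h : ρ.IsHermitian) (h' : ρ'.IsHermitian), ρ = ρ' →
      entropy ρ h = entropy ρ' h' := by
    rintro ρ ρ' h h' rfl
    rfl
  exact this _ _ _ _ (reducedRight_smul_ground z).symm

end Entropy

/-- The upper bound on Δ gives -log Δ ≥ 3 log N, which cancels the logarithm in the lower bound: -Δ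
log Δ ≥ 3/(4000 N⁴) ≥ (20 N)⁻⁴. The power -1/4 is then at most 20 N ≤ 40 (N - 1). -/
theorem rpow_gap_le {N : ℕ} (hN : 2 ≤ N) {Δ : ℝ} (h1 : Δ ≤ 2 / (N : ℝ) ^ 4)
    (h2 : 1 / 4000 / ((N : ℝ) ^ 4 * Real.log N) ≤ Δ) :
    1 / 40 * (-(Δ * Real.log Δ)) ^ (-(1 / 4) : ℝ) ≤ (N : ℝ) - 1 := by
  have hN2 : (2 : ℝ) ≤ N := by exact_mod_cast hN
  have hlog := half_le_log hN
  have hpos : 0 < Δ := lt_of_lt_of_le (by positivity) h2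
  have h3 : Δ ≤ ((N : ℝ) ^ 3)⁻¹ := by
    refine h1.trans ?_
    rw [div_le_iff₀ (by positivity), show ((N : ℝ) ^ 3)⁻¹ * (N : ℝ) ^ 4 = N by field_simp]
    exact hN2
  have h4 : 3 * Real.log N ≤ -Real.log Δ := by
    have := Real.log_le_log hpos h3
    rw [Real.log_inv, Real.log_pow] at this
    push_cast at this
    linarith
  have h5 : (20 * (N : ℝ)) ^ (-4 : ℝ) ≤ -(Δ * Real.log Δ) := by
    have e : (20 * (N : ℝ)) ^ (-4 : ℝ) = 1 / 160000 / (N : ℝ) ^ 4 := by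
      rw [Real.rpow_neg (by positivity), show (4 : ℝ) = ((4 : ℕ) : ℝ) by norm_num,
        Real.rpow_natCast]
      field_simp
      norm_num
    rw [e]
    calc 1 / 160000 / (N : ℝ) ^ 4 ≤ 3 / 4000 / (N : ℝ) ^ 4 := by gcongr <;> norm_num
      _ = 1 / 4000 / ((N : ℝ) ^ 4 * Real.log N) * (3 * Real.log N) := by field_simp
      _ ≤ Δ * (-Real.log Δ) := by gcongr
      _ = _ := by ring
  have h6 := Real.rpow_le_rpow_of_nonpos (z := (-(1 / 4) : ℝ)) (by positivity) h5 (by norm_num)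
  rw [← Real.rpow_mul (by positivity)] at h6
  norm_num at h6
  norm_num
  linarith

end TwoRing

end

theorem theorem1 :
    ∃ c : ℝ, 0 < c ∧ ∃ c' : ℝ, 0 < c' ∧
      ∀ (N : ℕ) [NeZero N], 2 ≤ N →
        (TwoRing.hamiltonian N (1 / (N : ℝ) ^ 4) 1).IsHermitian ∧
        ∃ E₀ Δ : ℝ,
          TwoRing.IsNondegenerateGroundEnergy
            (TwoRing.hamiltonian N (1 / (N : ℝ) ^ 4) 1) E₀ ∧
          TwoRing.IsGapAbove (TwoRing.hamiltonian N (1 / (N : ℝ) ^ 4) 1) E₀ Δ ∧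
          c / ((N : ℝ) ^ 4 * Real.log N) ≤ Δ ∧ Δ < 1 ∧
          ∀ g : TwoRing.Conf N × TwoRing.Conf N → ℂ,
            g ∈ TwoRing.energySpace (TwoRing.hamiltonian N (1 / (N : ℝ) ^ 4) 1) E₀ →
            ∑ s, ‖g s‖ ^ 2 = 1 →
            TwoRing.entropyLeft g = TwoRing.entropyRight g ∧
            (N : ℝ) - 1 ≤ TwoRing.entropyLeft g ∧
            c' * (-(Δ * Real.log Δ)) ^ (-(1 / 4) : ℝ) ≤ TwoRing.entropyLeft g := by
  refine ⟨1 / 4000, by norm_num, 1 / 40, by norm_num, fun N _ hN => ?_⟩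
  obtain ⟨Δ, hgap, hle, hge⟩ := TwoRing.exists_isGapAbove_zero hN
  have hN2 : (2 : ℝ) ≤ N := by exact_mod_cast hN
  refine ⟨TwoRing.hamiltonian_isHermitian _, 0, Δ, TwoRing.isNondegenerateGroundEnergy_zero hN,
    hgap, hge, lt_of_le_of_lt hle ?_, fun g hg hnorm => ?_⟩
  · rw [div_lt_one (by positivity)]
    have : (2 : ℝ) ^ 4 ≤ (N : ℝ) ^ 4 := by gcongr
    linarith
  · rw [TwoRing.mem_energySpace] at hg
    obtain ⟨z, rfl⟩ := TwoRing.eq_smul_ground hN (by simpa using hg)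
    have hS := TwoRing.entropyLeft_smul_ground hnorm
    refine ⟨TwoRing.entropyRight_smul_ground z, hS.ge, ?_⟩
    rw [hS]
    exact TwoRing.rpow_gap_le hN hle hge
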